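/- Let $(\Omega,\mathcal A,P)$ be a probability space and $d,d_x\in\mathbb N$; $\|\cdot\|$ is the Euclidean norm, $\|V\|_r=(E\|V\|^r)^{1/r}$, and $0$ also denotes the zero sequence. Let $(\xi_t,\eta_t)_{t\in\mathbb Z}$ be i.i.d., with $\xi_t$ real, $\eta_t$ in a measurable space $S$, $E\xi_0=0$ and $E\xi_0^2=1$. Let $\Theta\subset\mathbb R^d$ be compact, let $f_\theta,M_\theta:\mathbb R^{\mathbb N}\times(\mathbb R^{d_x})^{\mathbb N}\to\mathbb R$ ($\theta\in\mathbb R^d$) be functions that are measurable for $\theta\in\Theta$, put $H_\theta=M_\theta^2$, and let $g:(\mathbb R^{d_x})^{\mathbb N}\times S\to\mathbb R^{d_x}$ be measurable. Consider the model $$Y_t=M_\theta(Y_{t-1},Y_{t-2},\ldots;X_{t-1},X_{t-2},\ldots)\,\xi_t+f_\theta(Y_{t-1},Y_{t-2},\ldots;X_{t-1},X_{t-2},\ldots),\qquad X_t=g(X_{t-1},X_{t-2},\ldots;\eta_t),\qquad t\in\mathbb Z. \tag{1}$$ *Lipschitz conditions.* For $K\subset\mathbb R^d$ and $\Psi_\theta\in\{f_\theta,M_\theta\}$,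 condition $A_0(\Psi_\theta,K)$ holds with the non-negative summable sequences $(\alpha_{k,Y}(\Psi_\theta,K))_{k\ge1}$, $(\alpha_{k,X}(\Psi_\theta,K))_{k\ge1}$ if $\theta\mapsto\Psi_\theta(y,x)$ is continuous on $K$ for all $(y,x)$, $\sup_{\theta\in K}|\Psi_\theta(0,0)|<\infty$, and for all $(y,x),(y',x')$ $$\sup_{\theta\in K}|\Psi_\theta(y,x)-\Psi_\theta(y',x')|\le\sum_{k\ge1}\alpha_{k,Y}(\Psi_\theta,K)\,|y_k-y'_k|+\sum_{k\ge1}\alpha_{k,X}(\Psi_\theta,K)\,\|x_k-x'_k\|.$$ Condition $A_0(H_\theta,K)$ holds with the non-negative summable sequences $(\alpha_{k,Y}(H_\theta,K))_k$, $(\alpha_{k,X}(H_\theta,K))_k$ if $f_\theta=0$ for $\theta\in K$ and for all $(y,x),(y',x')$ $$\sup_{\theta\in K}|H_\theta(y,x)-H_\theta(y',x')|\le\sum_{k\ge1}\alpha_{k,Y}(H_\theta,K)\,|y_k^2-y_k'^2|+\sum_{k\ge1}\alpha_{k,X}(H_\theta,K)\,\|x_k-x'_k\|.$$ (These inequalities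 say nothing where the right-hand side is infinite; the same applies to the one below.) *Assumptions.* Let $r\ge1$ with $E|\xi_0|^r<\infty$. Assume that $A_0(f_\theta,\Theta)$ and $A_0(M_\theta,\Theta)$ hold, or that $A_0(H_\theta,\Theta)$ holds. Assume that $E\|g(0;\eta_0)\|^r<\infty$ and that, for a non-negative sequence $(\alpha_k(g))_{k\ge1}$ with $\sum_k\alpha_k(g)<1$, $$\|g(x;\eta_0)-g(x';\eta_0)\|_r\le\sum_{k\ge1}\alpha_k(g)\,\|x_k-x'_k\|\qquad\text{for all }x,x'\in(\mathbb R^{d_x})^{\mathbb N}.$$ Let $\Theta(r)=\Theta_1(r)\cup\Theta_2(r)$, where * $\Theta_1(r)$ is the set of $\theta\in\mathbb R^d$ such that $A_0(f_\theta,\{\theta\})$ and $A_0(M_\theta,\{\theta\})$ hold with coefficients satisfying $\sum_{k\ge1}\max\{\alpha_k(g),\ \alpha_{k,Y}(f_\theta,\{\theta\})+\|\xi_0\|_r\,\alpha_{k,Y}(M_\theta,\{\theta\})\}<1$; * $\Theta_2(r)$ is the set of $\theta\in\mathbb R^d$ such that $f_\theta=0$ and $A_0(H_\theta,\{\theta\})$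 holds with coefficients satisfying $\|\xi_0\|_r^2\sum_{k\ge1}\max\{\alpha_k(g),\ \alpha_{k,Y}(H_\theta,\{\theta\})\}<1$. Let $\theta^*\in\Theta\cap\Theta(r)$; if $\theta^*\notin\Theta_1(r)$, assume moreover that $r\ge2$ and $M_{\theta^*}\ge0$. *Conclusion.* There is a process $Z_t=(Y_t,X_t)$, $t\in\mathbb Z$, on $(\Omega,\mathcal A,P)$ that satisfies (1) with $\theta=\theta^*$ almost surely for every $t$, that is $\tau$-weakly dependent, strictly stationary, ergodic and non-anticipative, and that has $E\|Z_0\|^r<\infty$. Here *non-anticipative* means that there is a measurable function $\Phi$ with $Z_t=\Phi\big((\xi_t,\eta_t),(\xi_{t-1},\eta_{t-1}),\ldots\big)$ a.s. for every $t$. *$\tau$-weakly dependent* means that the $Z_t$ are integrable and $\tau_\infty(s)\to0$ as $s\to\infty$, where $$\tau_\infty(s)=\sup_{l\ge1}\ \frac1l\ \sup_{p\in\mathbb Z}\ \sup_{p+s\le j_1<\dots<j_l}\tau\big(\sigma(Z_t,\,t\le p),(Z_{j_1},\ldots,Z_{j_l})\big),\qquad \tau(\mathcal M,V)=E\Big[\sup_\varphi\Big|\int\varphi\,dP_{V|\mathcal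 M}-\int\varphi\,dP_V\Big|\Big],$$ $P_{V|\mathcal M}$ is the regular conditional law of $V$ given $\mathcal M$, and $\varphi$ runs over the real functions on $(\mathbb R^{1+d_x})^l$ that are 1-Lipschitz for the distance $\sum_{i=1}^l\|u_i-v_i\|$. -/

import Mathlib

open MeasureTheory ProbabilityTheory Filter Topology
open scoped NNReal ENNReal

namespace ACX

/-- The space `ℝ^{dx}` of covariate values, with its Euclidean norm. -/
abbrev Cov (dx : ℕ) : Type := EuclideanSpace ℝ (Fin dx)

/-- The space `ℝ × ℝ^{dx}` of values of `Z_t = (Y_t, X_t)`. -/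
abbrev State (dx : ℕ) : Type := ℝ × Cov dx

/-- The Euclidean norm of `z = (y, x)` in `ℝ^{1 + dx}` (the norm that a product carries in Mathlib
is the sup norm). -/
noncomputable def stateNorm {dx : ℕ} (z : State dx) : ℝ := Real.sqrt (z.1 ^ 2 + ‖z.2‖ ^ 2)

/-- The sequence `(z_{t-1}, z_{t-2}, …)`. The entry of index `k` is `z_{t-1-k}`, the lag `k + 1`;
all sequences indexed by the lags `1, 2, …` are written with this shift of the index. -/
def lags {β : Type*} (z : ℤ → β) (t : ℤ) : ℕ → β := fun k => z (t - 1 - k)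

/-! ### Lipschitz-type conditions -/

section Lipschitz

variable {d dx : ℕ}

/-- A family of functions `Ψ_θ(y, x)` of `y ∈ ℝ^ℕ` and `x ∈ (ℝ^{dx})^ℕ`, with `θ ∈ ℝ^d`. -/
abbrev Family (d dx : ℕ) : Type :=
  EuclideanSpace ℝ (Fin d) → (ℕ → ℝ) → (ℕ → Cov dx) → ℝ

/-- `Ψ` satisfies `A₀(Ψ_θ, K)` with Lipschitz coefficients `αY`, `αX`. The right-hand side of the
Lipschitz inequality is a series in `[0, ∞]`; nothing is required where it is infinite. -/
structure A0With (Ψ : Family d dx) (K : Set (EuclideanSpace ℝ (Fin d))) (αY αX : ℕ → ℝ≥0) :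
    Prop where
  continuousOn : ∀ y x, ContinuousOn (fun θ => Ψ θ y x) K
  bounded_zero : (⨆ θ ∈ K, ‖Ψ θ 0 0‖ₑ) < ∞
  summableY : Summable αY
  summableX : Summable αX
  lipschitz : ∀ (y y' : ℕ → ℝ) (x x' : ℕ → Cov dx),
    (⨆ θ ∈ K, ‖Ψ θ y x - Ψ θ y' x'‖ₑ) ≤
      (∑' k, (αY k : ℝ≥0∞) * ‖y k - y' k‖ₑ) + ∑' k, (αX k : ℝ≥0∞) * ‖x k - x' k‖ₑ

/-- The condition `A₀(Ψ_θ, K)`. -/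
def A0 (Ψ : Family d dx) (K : Set (EuclideanSpace ℝ (Fin d))) : Prop :=
  ∃ αY αX : ℕ → ℝ≥0, A0With Ψ K αY αX

/-- The condition `A₀(H_θ, K)`, `H_θ = M_θ ^ 2`, with Lipschitz coefficients `αY`, `αX`
(ARCH-X type processes, `f_θ = 0`). -/
structure A0HWith (f M : Family d dx) (K : Set (EuclideanSpace ℝ (Fin d))) (αY αX : ℕ → ℝ≥0) :
    Prop where
  f_eq_zero : ∀ θ ∈ K, ∀ y x, f θ y x = 0
  summableY : Summable αY
  summableX : Summable αX
  lipschitz : ∀ (y y' : ℕ → ℝ) (x x' : ℕ → Cov dx),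
    (⨆ θ ∈ K, ‖M θ y x ^ 2 - M θ y' x' ^ 2‖ₑ) ≤
      (∑' k, (αY k : ℝ≥0∞) * ‖y k ^ 2 - y' k ^ 2‖ₑ) + ∑' k, (αX k : ℝ≥0∞) * ‖x k - x' k‖ₑ

/-- The condition `A₀(H_θ, K)`. -/
def A0H (f M : Family d dx) (K : Set (EuclideanSpace ℝ (Fin d))) : Prop :=
  ∃ αY αX : ℕ → ℝ≥0, A0HWith f M K αY αX

end Lipschitz

section Model

variable {Ω S : Type*} [MeasurableSpace Ω] {d dx : ℕ}

/-- The moment and contraction condition of order `r` on the covariate recursion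
`X_t = g(X_{t-1}, X_{t-2}, …; η_t)`, with coefficients `αg`. -/
structure CovariateContraction (P : Measure Ω) (g : (ℕ → Cov dx) → S → Cov dx) (η : ℤ → Ω → S)
    (r : ℝ) (αg : ℕ → ℝ≥0) : Prop where
  moment : MemLp (fun ω => g 0 (η 0 ω)) (ENNReal.ofReal r) P
  lipschitz : ∀ x x' : ℕ → Cov dx,
    eLpNorm (fun ω => g x (η 0 ω) - g x' (η 0 ω)) (ENNReal.ofReal r) P ≤
      ∑' k, (αg k : ℝ≥0∞) * ‖x k - x' k‖ₑ
  sum_lt_one : ∑' k, (αg k : ℝ≥0∞) < 1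

/-- The first of the two sets whose union is `Θ(r)`. -/
def stationaritySetAffine (P : Measure Ω) (f M : Family d dx) (ξ : ℤ → Ω → ℝ) (r : ℝ)
    (αg : ℕ → ℝ≥0) : Set (EuclideanSpace ℝ (Fin d)) :=
  {θ | ∃ αfY αfX αMY αMX : ℕ → ℝ≥0, A0With f {θ} αfY αfX ∧ A0With M {θ} αMY αMX ∧
    ∑' k, max (αg k : ℝ≥0∞) (αfY k + eLpNorm (ξ 0) (ENNReal.ofReal r) P * αMY k) < 1}

/-- The second of the two sets whose union is `Θ(r)`, for ARCH-X type processes. -/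
def stationaritySetARCH (P : Measure Ω) (f M : Family d dx) (ξ : ℤ → Ω → ℝ) (r : ℝ)
    (αg : ℕ → ℝ≥0) : Set (EuclideanSpace ℝ (Fin d)) :=
  {θ | ∃ αHY αHX : ℕ → ℝ≥0, A0HWith f M {θ} αHY αHX ∧
    eLpNorm (ξ 0) (ENNReal.ofReal r) P ^ 2 * ∑' k, max (αg k : ℝ≥0∞) (αHY k) < 1}

/-- The set `Θ(r)`. -/
def stationaritySet (P : Measure Ω) (f M : Family d dx) (ξ : ℤ → Ω → ℝ) (r : ℝ)
    (αg : ℕ → ℝ≥0) : Set (EuclideanSpace ℝ (Fin d)) :=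
  stationaritySetAffine P f M ξ r αg ∪ stationaritySetARCH P f M ξ r αg

/-- `(Y, X)` solves, almost surely at every time `t`,
`Y_t = M_θ(Y_{t-1}, …; X_{t-1}, …) ξ_t + f_θ(Y_{t-1}, …; X_{t-1}, …)` and
`X_t = g(X_{t-1}, X_{t-2}, …; η_t)`. -/
def IsSolution (P : Measure Ω) (f M : Family d dx) (θ : EuclideanSpace ℝ (Fin d))
    (g : (ℕ → Cov dx) → S → Cov dx) (ξ : ℤ → Ω → ℝ) (η : ℤ → Ω → S)
    (Z : ℤ → Ω → State dx) : Prop :=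
  ∀ t : ℤ, ∀ᵐ ω ∂P,
    (Z t ω).1 =
        M θ (lags (fun s => (Z s ω).1) t) (lags (fun s => (Z s ω).2) t) * ξ t ω
          + f θ (lags (fun s => (Z s ω).1) t) (lags (fun s => (Z s ω).2) t) ∧
      (Z t ω).2 = g (lags (fun s => (Z s ω).2) t) (η t ω)

end Model

/-! ### Properties of processes indexed by `ℤ` -/

section Processes

variable {Ω : Type*} [MeasurableSpace Ω]

/-- Strict stationarity: the law of the path is invariant under all time shifts. -/
def StrictlyStationary {β : Type*} [MeasurableSpace β] (P : Measure Ω) (Z : ℤ → Ω → β) : Prop :=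
  ∀ h : ℤ, P.map (fun ω t => Z (t + h) ω) = P.map (fun ω t => Z t ω)

/-- Ergodicity: the time shift on the path space is ergodic for the law of the path. -/
def ErgodicProcess {β : Type*} [MeasurableSpace β] (P : Measure Ω) (Z : ℤ → Ω → β) : Prop :=
  Ergodic (fun (z : ℤ → β) (t : ℤ) => z (t + 1)) (P.map fun ω t => Z t ω)

/-- `Z` is non-anticipative with respect to the innovations `U`: every `Z_t` is (a.s.) a measurable
function of `U_t, U_{t-1}, …`, the same for all `t`. -/
def NonAnticipative {β γ : Type*} [MeasurableSpace β] [MeasurableSpace γ] (P : Measure Ω)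
    (U : ℤ → Ω → γ) (Z : ℤ → Ω → β) : Prop :=
  ∃ Φ : (ℕ → γ) → β, Measurable Φ ∧ ∀ t : ℤ, ∀ᵐ ω ∂P, Z t ω = Φ fun k => U (t - k) ω

/-- The functions on `(ℝ^{1 + dx})^l` that are 1-Lipschitz for the distance `∑ i, ‖u_i - v_i‖`. -/
def lipOne (dx l : ℕ) : Set ((Fin l → State dx) → ℝ) :=
  {φ | ∀ u v, |φ u - φ v| ≤ ∑ i, stateNorm (u i - v i)}

/-- The coefficient
`τ(σ(W), V) = E [ sup_φ |∫ φ dP_{V | σ(W)} - ∫ φ dP_V| ]`, the supremum over 1-Lipschitz `φ`. -/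
noncomputable def tauCoeff {β : Type*} [MeasurableSpace β] {dx l : ℕ} (P : Measure Ω)
    [IsFiniteMeasure P] (W : Ω → β) (V : Ω → Fin l → State dx) : ℝ≥0∞ :=
  ∫⁻ ω, ⨆ φ ∈ lipOne dx l,
    ‖(∫ v, φ v ∂(condDistrib V W P (W ω))) - ∫ v, φ v ∂(P.map V)‖ₑ ∂P

/-- The coefficient `τ_∞(s)`: the supremum, over `l ≥ 1`, over `p ∈ ℤ` and over the times
`p + s ≤ j_1 < … < j_l`, of `l⁻¹ τ(σ(Z_t, t ≤ p), (Z_{j_1}, …, Z_{j_l}))`. -/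
noncomputable def tau {dx : ℕ} (P : Measure Ω) [IsFiniteMeasure P] (Z : ℤ → Ω → State dx)
    (s : ℕ) : ℝ≥0∞ :=
  ⨆ (l : ℕ) (_ : 1 ≤ l) (p : ℤ) (j : Fin l → ℤ) (_ : StrictMono j) (_ : ∀ i, p + s ≤ j i),
    (l : ℝ≥0∞)⁻¹ * tauCoeff P (fun ω (k : ℕ) => Z (p - k) ω) (fun ω i => Z (j i) ω)

/-- `τ`-weak dependence of an integrable process: `τ_∞(s) → 0` as `s → ∞`. -/
def TauWeaklyDependent {dx : ℕ} (P : Measure Ω) [IsFiniteMeasure P] (Z : ℤ → Ω → State dx) :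
    Prop :=
  (∀ t, Integrable (Z t) P) ∧ Tendsto (tau P Z) atTop (𝓝 0)

end Processes

end ACX

/-! Write `U t = (ξ t, η t)`. It suffices to find one measurable functional `Φ` in `L^r` of an
i.i.d. sequence such that `Z t = Φ (U t, U (t - 1), …)` solves the model. The rest follows from this
form. The path of `Z` is a shift-equivariant image of the Bernoulli shift, so it is stationary and
ergodic (`ergodic_shift_infinitePi`, `ergodicProcess_of_iid`). Lévy's theorem approximates `Φ` in
`L¹` by functionals of finitely many innovations, so the far future is `L¹`-close to a variable
independent of the past (`tauCoeff_le_of_indepFun`, `tauWeaklyDependent_of_iid`).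

`Φ` is the limit of the Picard iterates started at 0 (`IsPicardContraction.exists_fixedPoint`). The
newest innovation is independent of the past, so Lipschitz bounds at deterministic pasts pass to
random pasts by Fubini and Minkowski. The system is triangular, since `X` evolves without `Y`:
increments decay geometrically once the coefficients of `X` in `X` and of `Y` in `Y` each sum to
less than 1, while those of `X` in `Y` need only be summable.

In the affine case `Y` contracts in `L^r`. In the ARCH case `Y²` contracts in `L^(r/2)`, and `M ≥ 0`
gives `|M - M'|² ≤ |M² - M'²|`, which returns control of `Y` in `L^r` with Hölder exponent 1/2.
`IsPicardContraction` covers both through a function `ψ` (identity or square) and an exponent `q`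
(`r` or `r / 2`). -/

namespace ACX

/-! ### Independent blocks and ergodicity of the Bernoulli shift. -/

section IndependentSequences

variable {Ω ι γ : Type*} [MeasurableSpace Ω] [MeasurableSpace γ] {P : Measure Ω}

/-- The subfamilies of an independent family over disjoint index sets are independent. -/
theorem indepFun_restrict_of_disjoint {X : ι → Ω → γ} (hX : ∀ i, Measurable (X i))
    (h : iIndepFun X P) {S T : Set ι} (hST : Disjoint S T) :
    IndepFun (fun ω (i : S) => X i ω) (fun ω (i : T) => X i ω) P := by
  have := indep_iSup_of_disjoint (fun i => (hX i).comap_le) h.iIndep hST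
  rw [IndepFun_iff_Indep]
  convert this using 1 <;>
  simp only [MeasurableSpace.pi, MeasurableSpace.comap_iSup, MeasurableSpace.comap_comp,
    iSup_subtype, Function.comp_def]

theorem indepFun_of_factorsThrough_disjoint {α β : Type*} [MeasurableSpace α] [MeasurableSpace β]
    {X : ι → Ω → γ} (hX : ∀ i, Measurable (X i)) (h : iIndepFun X P) {S T : Set ι}
    (hST : Disjoint S T) {F : (S → γ) → α} {G : (T → γ) → β} (hF : Measurable F)
    (hG : Measurable G) :
    IndepFun (fun ω => F fun i => X i ω) (fun ω => G fun i => X i ω) P :=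
  (indepFun_restrict_of_disjoint hX h hST).comp hF hG

variable (μ : Measure γ) [IsProbabilityMeasure μ]

theorem iIndepFun_eval_infinitePi :
    iIndepFun (fun (i : ι) (u : ι → γ) => u i) (Measure.infinitePi fun _ : ι => μ) :=
  iIndepFun_infinitePi (P := fun _ => μ) (X := fun _ x => x) (fun _ => measurable_id)

theorem measurePreserving_reindex_infinitePi {κ : Type*} {e : κ → ι} (he : e.Injective) :
    MeasurePreserving (fun (u : ι → γ) k => u (e k)) (Measure.infinitePi fun _ => μ)
      (Measure.infinitePi fun _ => μ) :=
  ⟨by fun_prop, Measure.map_infinitePi_infinitePi_of_inj (P := fun _ => μ) he⟩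

/-- The head and the tail of an i.i.d. sequence are independent. -/
theorem measurePreserving_head_tail :
    MeasurePreserving (fun u : ℕ → γ => (u 0, fun k => u (k + 1)))
      (Measure.infinitePi fun _ => μ) (μ.prod (Measure.infinitePi fun _ => μ)) := by
  refine ⟨by fun_prop, ?_⟩
  have hind := indepFun_of_factorsThrough_disjoint (X := fun (i : ℕ) (u : ℕ → γ) => u i)
    (fun i => by fun_prop) (iIndepFun_eval_infinitePi μ) (S := {0}) (T := {0}ᶜ)
    disjoint_compl_right (F := fun u => u ⟨0, rfl⟩)
    (G := fun u (k : ℕ) => u ⟨k + 1, k.succ_ne_zero⟩) (by fun_prop) (by fun_prop)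
  dsimp only at hind
  rw [indepFun_iff_map_prod_eq_prod_map_map (Measurable.aemeasurable (by fun_prop))
    (Measurable.aemeasurable (by fun_prop))] at hind
  rw [hind, Measure.infinitePi_map_eval (fun _ : ℕ => μ) 0,
    (measurePreserving_reindex_infinitePi μ (add_left_injective 1)).map_eq]

/-- The two-sided Bernoulli shift is ergodic. -/
theorem ergodic_shift_infinitePi :
    Ergodic (fun (u : ℤ → γ) t => u (t + 1)) (Measure.infinitePi fun _ => μ) := by
  set R : Measure (ℤ → γ) := Measure.infinitePi fun _ => μ with hR
  have hmp (n : ℤ) : MeasurePreserving (fun (u : ℤ → γ) t => u (t + n)) R R :=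
    measurePreserving_reindex_infinitePi μ (add_left_injective n)
  refine ⟨hmp 1, ⟨fun A hA hinv => ?_⟩⟩
  have hinvn (n : ℕ) : (fun (u : ℤ → γ) t => u (t + n)) ⁻¹' A = A := by
    induction n with
    | zero => simp
    | succ n ih =>
      conv_rhs => rw [← hinv, ← ih]
      ext u
      simp [add_assoc]
  -- Mixing argument: `A` is within `ε` of a cylinder `C`, and so of any shift of `C` because `A` is
  -- invariant. A large shift makes `C` independent of itself, so `R A` is close to `(R C)²`, hence
  -- to `(R A)²`. The intersection costs `2ε` and comparing the two squares another `2ε`.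
  have key (ε : ℝ) (hε : 0 < ε) : |R.real A - R.real A * R.real A| ≤ 4 * ε := by
    obtain ⟨C, hC, hCA⟩ := exists_measure_symmDiff_lt_of_generateFrom_isSetRing (μ := R)
      (isSetRing_measurableCylinders (α := fun _ : ℤ => γ))
      ⟨{Set.univ}, by simp, by simpa using univ_mem_measurableCylinders (fun _ : ℤ => γ), by simp⟩
      generateFrom_measurableCylinders.symm hA (ENNReal.ofReal_pos.2 hε)
    obtain ⟨I, S, hS, rfl⟩ := (mem_measurableCylinders _).1 hC
    have hCm : MeasurableSet (cylinder (α := fun _ : ℤ => γ) I S) := hS.cylinder I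
    set C : Set (ℤ → γ) := cylinder I S
    obtain ⟨n, hn⟩ : ∃ n : ℕ, Disjoint (I : Set ℤ) ((fun i => i + (n : ℤ)) '' I) := by
      obtain ⟨b, hb⟩ := (I.finite_toSet.image fun i => |i|).bddAbove
      -- The coordinates in `I` lie in `[-b, b]`, so a shift by more than `2b` separates them from
      -- their translates.
      refine ⟨(2 * b + 1).toNat, Set.disjoint_left.2 ?_⟩
      rintro _ hi ⟨j, hj, rfl⟩
      have h1 := hb ⟨_, hi, rfl⟩
      have h2 := hb ⟨_, hj, rfl⟩
      simp only at h1 h2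
      rw [abs_le] at h1 h2
      omega
    set T : (ℤ → γ) → ℤ → γ := fun u t => u (t + n) with hT
    have hTm : MeasurePreserving T R R := hmp n
    have hind := indepFun_of_factorsThrough_disjoint (X := fun (i : ℤ) (u : ℤ → γ) => u i)
      (fun i => by fun_prop) (iIndepFun_eval_infinitePi μ) hn
      (F := fun u (i : I) => u ⟨i, i.2⟩)
      (G := fun u (i : I) => u ⟨i + n, i, i.2, rfl⟩) (by fun_prop) (by fun_prop)
    have hprod : R (C ∩ T ⁻¹' C) =
        R C * R (T ⁻¹' C) := hind.measure_inter_preimage_eq_mul _ _ hS hS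
    have hTC : R.real (T ⁻¹' C) = R.real C :=
      hTm.measureReal_preimage hCm.nullMeasurableSet
    have hprod' : R.real (C ∩ T ⁻¹' C) =
        R.real C * R.real C := by
      have : R.real (C ∩ T ⁻¹' C) = R.real C * R.real (T ⁻¹' C) := by
        simp [measureReal_def, hprod]
      rw [this, hTC]
    have hsymm : R.real (symmDiff C A) ≤ ε :=
      ENNReal.toReal_le_of_le_ofReal hε.le hCA.le
    have hsymm' : R.real (symmDiff (T ⁻¹' C) A) ≤ ε := by
      have : symmDiff (T ⁻¹' C) A = T ⁻¹' symmDiff C A := by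
        conv_lhs => rw [← hinvn n]
        rfl
      rw [this, hTm.measureReal_preimage (hCm.symmDiff hA).nullMeasurableSet]
      exact hsymm
    have h1 := (abs_measureReal_sub_le_measureReal_symmDiff (μ := R) hCm.nullMeasurableSet
      hA.nullMeasurableSet).trans hsymm
    have h2 : |R.real (C ∩ T ⁻¹' C) - R.real A| ≤ 2 * ε := by
      refine (abs_measureReal_sub_le_measureReal_symmDiff
        (hCm.inter (hTm.measurable hCm)).nullMeasurableSet hA.nullMeasurableSet).trans ?_
      calc R.real (symmDiff (C ∩ T ⁻¹' C) A)
          ≤ R.real (symmDiff C A ∪ symmDiff (T ⁻¹' C) A) := by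
            refine measureReal_mono ?_
            intro u
            simp only [Set.mem_symmDiff, Set.mem_inter_iff, Set.mem_union]
            tauto
        _ ≤ _ := (measureReal_union_le _ _).trans (by linarith)
    rw [hprod'] at h2
    have h3 : R.real C ≤ 1 := measureReal_le_one
    have h4 : R.real A ≤ 1 := measureReal_le_one
    have h5 : 0 ≤ R.real C := measureReal_nonneg
    have h6 : 0 ≤ R.real A := measureReal_nonneg
    rw [abs_le] at h1 h2 ⊢
    constructor <;> nlinarith
  have hz : R.real A - R.real A * R.real A = 0 := by
    refine abs_eq_zero.1 (le_antisymm (le_of_forall_pos_le_add fun ε hε => ?_) (abs_nonneg _))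
    linarith [key (ε / 4) (by positivity)]
  have hz' : R.real A = 0 ∨ R.real A = 1 := by
    rcases mul_eq_zero.1 (show R.real A * (1 - R.real A) = 0 by linarith) with h | h
    · exact .inl h
    · exact .inr (by linarith)
  rw [eventuallyConst_set']
  rcases hz' with h | h
  · exact .inl (ae_eq_empty.2 ((measureReal_eq_zero_iff).1 h))
  · refine .inr (eventuallyEq_univ.2 ((prob_compl_eq_zero_iff hA).2 ?_))
    rw [measureReal_def, ENNReal.toReal_eq_one_iff] at h
    exact h

end IndependentSequences

/-! ### Bounding the τ coefficient by coupling. -/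

section Coupling

variable {dx : ℕ}

@[fun_prop]
theorem continuous_stateNorm : Continuous (stateNorm : State dx → ℝ) := by
  unfold stateNorm
  fun_prop

theorem stateNorm_nonneg (z : State dx) : 0 ≤ stateNorm z := Real.sqrt_nonneg _

theorem stateNorm_zero : stateNorm (0 : State dx) = 0 := by simp [stateNorm]

theorem stateNorm_le_add (z : State dx) : stateNorm z ≤ ‖z.1‖ + ‖z.2‖ := by
  refine Real.sqrt_le_iff.2 ⟨by positivity, ?_⟩
  rw [Real.norm_eq_abs]
  nlinarith [sq_abs z.1, mul_nonneg (abs_nonneg z.1) (norm_nonneg z.2)]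

theorem stateNorm_le_two_mul_norm (z : State dx) : stateNorm z ≤ 2 * ‖z‖ := by
  linarith [stateNorm_le_add z, norm_fst_le z, norm_snd_le z]

theorem integrable_stateNorm {α : Type*} [MeasurableSpace α] {ν : Measure α} {V : α → State dx}
    (hV : Integrable V ν) : Integrable (fun a => stateNorm (V a)) ν := by
  refine (hV.norm.const_mul 2).mono'
    (continuous_stateNorm.comp_aestronglyMeasurable hV.aestronglyMeasurable) (.of_forall fun a => ?_)
  rw [Real.norm_of_nonneg (stateNorm_nonneg _)]
  exact stateNorm_le_two_mul_norm _

variable {l : ℕ}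

theorem continuous_of_mem_lipOne {φ : (Fin l → State dx) → ℝ} (hφ : φ ∈ lipOne dx l) :
    Continuous φ := by
  refine continuous_iff_continuousAt.2 fun v => ?_
  rw [ContinuousAt, tendsto_iff_dist_tendsto_zero]
  have h : Tendsto (fun u : Fin l → State dx => ∑ i, stateNorm (u i - v i)) (𝓝 v) (𝓝 0) := by
    have : Continuous fun u : Fin l → State dx => ∑ i, stateNorm (u i - v i) := by fun_prop
    simpa [stateNorm_zero] using this.tendsto v
  exact squeeze_zero (fun _ => dist_nonneg) (fun u => hφ u v) h

theorem integrable_of_mem_lipOne {α : Type*} [MeasurableSpace α] {ν : Measure α}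
    [IsFiniteMeasure ν] {φ : (Fin l → State dx) → ℝ} (hφ : φ ∈ lipOne dx l)
    {V : α → Fin l → State dx} (hV : Measurable V)
    (hint : Integrable (fun a => ∑ i, stateNorm (V a i)) ν) : Integrable (fun a => φ (V a)) ν := by
  refine ((integrable_const |φ 0|).add hint).mono'
    ((continuous_of_mem_lipOne hφ).measurable.comp hV).aestronglyMeasurable
    (.of_forall fun a => ?_)
  have h := hφ (V a) 0
  simp only [Pi.zero_apply, sub_zero] at h
  rw [Real.norm_eq_abs]
  simp only [Pi.add_apply]
  linarith [abs_sub_abs_le_abs_sub (φ (V a)) (φ 0)]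

/-- The easy half of Kantorovich duality: the cost of any coupling bounds the integral differences,
uniformly in `φ`. -/
theorem enorm_integral_sub_integral_le {α : Type*} [MeasurableSpace α] {ν : Measure α}
    [IsFiniteMeasure ν] {φ : (Fin l → State dx) → ℝ} (hφ : φ ∈ lipOne dx l)
    {V V' : α → Fin l → State dx} (hV : Measurable V) (hV' : Measurable V')
    (hint : Integrable (fun a => ∑ i, stateNorm (V a i)) ν)
    (hint' : Integrable (fun a => ∑ i, stateNorm (V' a i)) ν) :
    ‖(∫ v, φ v ∂ν.map V) - ∫ v, φ v ∂ν.map V'‖ₑ ≤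
      ∫⁻ a, ENNReal.ofReal (∑ i, stateNorm (V a i - V' a i)) ∂ν := by
  have hm := (continuous_of_mem_lipOne hφ).measurable
  rw [integral_map hV.aemeasurable hm.aestronglyMeasurable,
    integral_map hV'.aemeasurable hm.aestronglyMeasurable,
    ← integral_sub (integrable_of_mem_lipOne hφ hV hint) (integrable_of_mem_lipOne hφ hV' hint')]
  refine (enorm_integral_le_lintegral_enorm _).trans (lintegral_mono fun a => ?_)
  rw [Real.enorm_eq_ofReal_abs]
  exact ENNReal.ofReal_le_ofReal (hφ _ _)

/-- Gives almost every conditional law a finite first moment, so that 1-Lipschitz functions are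
genuinely integrable under it and the Bochner integral does not take its default value 0. -/
theorem ae_integrable_condDistrib {Ω β A : Type*} [MeasurableSpace Ω] [MeasurableSpace β]
    [MeasurableSpace A] [StandardBorelSpace A] [Nonempty A] {P : Measure Ω} [IsFiniteMeasure P]
    {W : Ω → β} {V : Ω → A} (hW : Measurable W) (hV : Measurable V) {h : A → ℝ}
    (hh : Measurable h) (hint : Integrable (fun ω => h (V ω)) P) :
    ∀ᵐ w ∂P.map W, Integrable h (condDistrib V W P w) :=
  Integrable.condDistrib_ae_map (f := fun p => h p.2) hV.aemeasurable
    ((integrable_map_measure (hh.comp measurable_snd).aestronglyMeasurable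
      (hW.prodMk hV).aemeasurable).2 hint)

/-- Replacing the future `V` by a variable `V'` independent of the past `W` bounds the coefficient
`τ(σ(W), V)`. -/
theorem tauCoeff_le_of_indepFun {Ω β : Type*} [MeasurableSpace Ω] [MeasurableSpace β]
    {P : Measure Ω} [IsProbabilityMeasure P] {W : Ω → β} {V V' : Ω → Fin l → State dx}
    (hW : Measurable W) (hV : Measurable V) (hV' : Measurable V')
    (hint : ∀ i, Integrable (fun ω => V ω i) P) (hint' : ∀ i, Integrable (fun ω => V' ω i) P)
    (hind : IndepFun W V' P) :
    tauCoeff P W V ≤ 2 * ∑ i, ∫⁻ ω, ENNReal.ofReal (stateNorm (V ω i - V' ω i)) ∂P := by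
  set D : (Fin l → State dx) × (Fin l → State dx) → ℝ≥0∞ :=
    fun q => ENNReal.ofReal (∑ i, stateNorm (q.1 i - q.2 i)) with hD
  have hDm : Measurable D := by
    have : Continuous fun q : (Fin l → State dx) × (Fin l → State dx) =>
      ∑ i, stateNorm (q.1 i - q.2 i) := by fun_prop
    exact ENNReal.measurable_ofReal.comp this.measurable
  have hVV' : Measurable fun ω => (V ω, V' ω) := hV.prodMk hV'
  have : StandardBorelSpace (Fin l → State dx) := inferInstance
  -- Conditioning the pair jointly makes `κ w` a coupling of the conditional laws of `V` and `V'`,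
  -- to which the transport bound applies for almost every `w`.
  set κ := condDistrib (fun ω => (V ω, V' ω)) W P with hκ
  have h1 : condDistrib V W P =ᵐ[P.map W] κ.map Prod.fst :=
    condDistrib_comp W hVV'.aemeasurable measurable_fst
  have h2 : condDistrib V' W P =ᵐ[P.map W] κ.map Prod.snd :=
    condDistrib_comp W hVV'.aemeasurable measurable_snd
  -- By independence, conditioning on `W` does not change the law of `V'`.
  have h3 : condDistrib V' W P =ᵐ[P.map W] Kernel.const β (P.map V') := by
    have : IsProbabilityMeasure (P.map V') := Measure.isProbabilityMeasure_map hV'.aemeasurable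
    refine condDistrib_ae_eq_of_measure_eq_compProd W hV'.aemeasurable ?_
    rw [Measure.compProd_const]
    exact (indepFun_iff_map_prod_eq_prod_map_map hW.aemeasurable hV'.aemeasurable).1 hind
  have hsum : Integrable (fun ω => ∑ i, stateNorm (V ω i)) P :=
    integrable_finsetSum _ fun i _ => integrable_stateNorm (hint i)
  have hsum' : Integrable (fun ω => ∑ i, stateNorm (V' ω i)) P :=
    integrable_finsetSum _ fun i _ => integrable_stateNorm (hint' i)
  have hcont : Continuous fun v : Fin l → State dx => ∑ i, stateNorm (v i) := by fun_prop
  have h4 : ∀ᵐ w ∂P.map W, Integrable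
      (fun q : (Fin l → State dx) × (Fin l → State dx) => ∑ i, stateNorm (q.1 i)) (κ w) :=
    ae_integrable_condDistrib hW hVV' (hcont.measurable.comp measurable_fst) hsum
  have h5 : ∀ᵐ w ∂P.map W, Integrable
      (fun q : (Fin l → State dx) × (Fin l → State dx) => ∑ i, stateNorm (q.2 i)) (κ w) :=
    ae_integrable_condDistrib hW hVV' (hcont.measurable.comp measurable_snd) hsum'
  set c := ∫⁻ ω, D (V ω, V' ω) ∂P with hc
  have hbound : ∀ᵐ w ∂P.map W, ⨆ φ ∈ lipOne dx l,
      ‖(∫ v, φ v ∂(condDistrib V W P w)) - ∫ v, φ v ∂(P.map V)‖ₑ ≤ ∫⁻ q, D q ∂κ w + c := by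
    filter_upwards [h1, h2, h3, h4, h5] with w h1 h2 h3 h4 h5
    refine iSup₂_le fun φ hφ => ?_
    have e1 := enorm_integral_sub_integral_le (ν := κ w) hφ measurable_fst measurable_snd h4 h5
    have e2 := enorm_integral_sub_integral_le hφ hV' hV hsum' hsum
    rw [← Kernel.map_apply _ measurable_fst, ← Kernel.map_apply _ measurable_snd, ← h1, ← h2, h3,
      Kernel.const_apply] at e1
    have e3 : ∫⁻ ω, ENNReal.ofReal (∑ i, stateNorm (V' ω i - V ω i)) ∂P = c := by
      refine lintegral_congr fun ω => ?_
      simp only [hD]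
      congr 2 with i
      simp only [stateNorm, Prod.fst_sub, Prod.snd_sub]
      rw [norm_sub_rev, ← neg_sub, neg_sq]
    rw [e3] at e2
    -- Triangle inequality through the law of `V'`. The conditional and the unconditional comparison
    -- each cost `c` on average, whence the factor 2.
    refine le_trans ?_ (add_le_add e1 e2)
    rw [← sub_add_sub_cancel _ (∫ v, φ v ∂(P.map V'))]
    exact enorm_add_le _ _
  have hc' : c = ∑ i, ∫⁻ ω, ENNReal.ofReal (stateNorm (V ω i - V' ω i)) ∂P := by
    rw [hc, ← lintegral_finsetSum]
    · exact lintegral_congr fun ω => ENNReal.ofReal_sum_of_nonneg fun _ _ => stateNorm_nonneg _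
    · intro i _
      exact ENNReal.measurable_ofReal.comp (continuous_stateNorm.measurable.comp
        (((measurable_pi_apply i).comp hV).sub ((measurable_pi_apply i).comp hV')))
  have hκc : ∫⁻ ω, ∫⁻ q, D q ∂κ (W ω) ∂P = c := by
    rw [← lintegral_map (f := fun w => ∫⁻ q, D q ∂κ w) hDm.lintegral_kernel hW,
      ← Measure.lintegral_bind κ.aemeasurable hDm.aemeasurable,
      condDistrib_comp_map hW.aemeasurable hVV'.aemeasurable, lintegral_map hDm hVV']
  calc tauCoeff P W V ≤ ∫⁻ ω, (∫⁻ q, D q ∂κ (W ω) + c) ∂P :=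
        lintegral_mono_ae (ae_of_ae_map hW.aemeasurable hbound)
    _ = 2 * ∑ i, ∫⁻ ω, ENNReal.ofReal (stateNorm (V ω i - V' ω i)) ∂P := by
        rw [lintegral_add_right _ measurable_const, hκc, lintegral_const, measure_univ, mul_one,
          ← hc', two_mul]

end Coupling

/-! ### `L¹` approximation by functionals of finite memory. -/

section FiniteMemory

variable {γ : Type*} [MeasurableSpace γ]

/-- Identifies the limit in Lévy's upward theorem as `Φ` itself. -/
theorem iSup_piLE_nat : ⨆ n : ℕ, (Filtration.piLE (X := fun _ : ℕ => γ)) n = MeasurableSpace.pi := by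
  refine le_antisymm (iSup_le fun n => Filtration.le _ n) (iSup_le fun n => ?_)
  refine le_trans ?_ (le_iSup _ n)
  rintro _ ⟨s, hs, rfl⟩
  exact ⟨(fun u => u ⟨n, Set.mem_Iic.2 le_rfl⟩) ⁻¹' s, measurable_pi_apply _ hs, rfl⟩

/-- `Ψ n` is the conditional expectation of `Φ` given the coordinates `0, …, n`, factored through
them by Doob–Dynkin; the convergence is Lévy's upward theorem in `L¹`. -/
theorem exists_finiteMemory_tendsto_real {Q : Measure (ℕ → γ)} [IsFiniteMeasure Q]
    {Φ : (ℕ → γ) → ℝ} (hΦ : Measurable Φ) (hint : Integrable Φ Q) :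
    ∃ Ψ : (n : ℕ) → (Set.Iic n → γ) → ℝ, (∀ n, Measurable (Ψ n)) ∧
      (∀ n, Integrable (fun u => Ψ n fun i => u i) Q) ∧
      Tendsto (fun n => ∫⁻ u, ‖Φ u - Ψ n fun i => u i‖ₑ ∂Q) atTop (𝓝 0) := by
  have h (n : ℕ) : ∃ Ψ : (Set.Iic n → γ) → ℝ, Measurable Ψ ∧
      Q[Φ | Filtration.piLE (X := fun _ : ℕ => γ) n] = Ψ ∘ Preorder.restrictLe n := by
    have := (stronglyMeasurable_condExp (f := Φ) (μ := Q)
      (m := Filtration.piLE (X := fun _ : ℕ => γ) n)).measurable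
    exact this.exists_eq_measurable_comp
  choose Ψ hΨm hΨ using h
  refine ⟨Ψ, hΨm, fun n => ?_, ?_⟩
  · have := integrable_condExp (f := Φ) (μ := Q) (m := Filtration.piLE (X := fun _ : ℕ => γ) n)
    rwa [hΨ n] at this
  · have := tendsto_eLpNorm_condExp (μ := Q) (ℱ := Filtration.piLE (X := fun _ : ℕ => γ)) Φ
    rw [iSup_piLE_nat, condExp_of_stronglyMeasurable le_rfl hΦ.stronglyMeasurable hint] at this
    refine this.congr fun n => ?_
    rw [eLpNorm_one_eq_lintegral_enorm]
    refine lintegral_congr fun u => ?_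
    rw [hΨ n, Pi.sub_apply, enorm_sub_rev]
    rfl

/-- An integrable function of a random sequence is approximated in `L¹` by functions of finitely
many terms. -/
theorem exists_finiteMemory_tendsto {dx : ℕ} {Q : Measure (ℕ → γ)} [IsFiniteMeasure Q]
    {Φ : (ℕ → γ) → State dx} (hΦ : Measurable Φ) (hint : Integrable Φ Q) :
    ∃ Ψ : (n : ℕ) → (Set.Iic n → γ) → State dx, (∀ n, Measurable (Ψ n)) ∧
      (∀ n, Integrable (fun u => Ψ n fun i => u i) Q) ∧
      Tendsto (fun n => ∫⁻ u, ENNReal.ofReal (stateNorm (Φ u - Ψ n fun i => u i)) ∂Q)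
        atTop (𝓝 0) := by
  obtain ⟨Ψ₁, hm₁, hi₁, ht₁⟩ := exists_finiteMemory_tendsto_real hΦ.fst hint.fst
  have hΦ₂ (k : Fin dx) : Measurable fun u => (Φ u).2 k := by fun_prop
  have hint₂ (k : Fin dx) : Integrable (fun u => (Φ u).2 k) Q :=
    hint.snd.mono (hΦ₂ k).aestronglyMeasurable (.of_forall fun u => PiLp.norm_apply_le _ k)
  choose Ψ₂ hm₂ hi₂ ht₂ using fun k => exists_finiteMemory_tendsto_real (hΦ₂ k) (hint₂ k)
  have hm (n : ℕ) : Measurable fun v : Set.Iic n → γ =>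
      ((Ψ₁ n v, WithLp.toLp 2 fun k => Ψ₂ k n v) : State dx) :=
    (hm₁ n).prodMk ((WithLp.measurable_toLp 2 _).comp (measurable_pi_lambda _ fun k => hm₂ k n))
  -- The Euclidean norm is at most the sum of the coordinate norms, so the scalar case applied to
  -- each coordinate suffices.
  have hle (z : Cov dx) : ‖z‖ ≤ ∑ k, ‖z k‖ := by
    rw [EuclideanSpace.norm_eq]
    refine Real.sqrt_le_iff.2 ⟨by positivity, ?_⟩
    exact Finset.sum_sq_le_sq_sum_of_nonneg fun _ _ => norm_nonneg _
  refine ⟨fun n v => (Ψ₁ n v, WithLp.toLp 2 fun k => Ψ₂ k n v), hm, fun n => ?_, ?_⟩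
  · refine (hi₁ n).prodMk ?_
    refine (integrable_finsetSum Finset.univ fun k _ => (hi₂ k n).norm).mono' ?_
      (.of_forall fun u => hle _)
    exact ((hm n).snd.comp (by fun_prop)).aestronglyMeasurable
  · have hsum : Tendsto (fun n => ∫⁻ u, ‖(Φ u).1 - Ψ₁ n fun i => u i‖ₑ ∂Q +
        ∑ k, ∫⁻ u, ‖(Φ u).2 k - Ψ₂ k n fun i => u i‖ₑ ∂Q) atTop (𝓝 0) := by
      simpa using ht₁.add (tendsto_finsetSum Finset.univ fun k _ => ht₂ k)
    refine tendsto_of_tendsto_of_tendsto_of_le_of_le tendsto_const_nhds hsum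
      (fun _ => zero_le) fun n => ?_
    have hm₂' (k : Fin dx) : Measurable fun u : ℕ → γ => ‖(Φ u).2 k - Ψ₂ k n fun i => u i‖ₑ :=
      ((hΦ₂ k).sub ((hm₂ k n).comp (by fun_prop))).enorm
    dsimp only
    rw [← lintegral_finsetSum _ fun k _ => hm₂' k,
      ← lintegral_add_right _ (Finset.measurable_fun_sum _ fun k _ => hm₂' k)]
    refine lintegral_mono fun u => ?_
    refine (ENNReal.ofReal_le_ofReal ((stateNorm_le_add _).trans
      (add_le_add_right (hle _) _))).trans ?_
    rw [ENNReal.ofReal_add (norm_nonneg _) (by positivity),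
      ENNReal.ofReal_sum_of_nonneg fun _ _ => norm_nonneg _]
    simp only [ofReal_norm]
    exact le_rfl

end FiniteMemory

/-! ### `L^p` norms of series and of sequences with geometric increments. -/

section LpNorms

variable {α : Type*} [MeasurableSpace α] {ν : Measure α} {p : ℝ}

theorem eLpNorm_ofReal_eq_lintegral {ε : Type*} [ENorm ε] (hp : 0 < p) (f : α → ε) :
    eLpNorm f (ENNReal.ofReal p) ν = (∫⁻ a, ‖f a‖ₑ ^ p ∂ν) ^ (1 / p) := by
  rw [eLpNorm_eq_lintegral_rpow_enorm_toReal (by simpa using hp) ENNReal.ofReal_ne_top,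
    ENNReal.toReal_ofReal hp.le]

theorem eLpNorm_const_mul_ennreal (hp : 0 < p) (c : ℝ≥0∞) {f : α → ℝ≥0∞} (hf : Measurable f) :
    eLpNorm (fun a => c * f a) (ENNReal.ofReal p) ν = c * eLpNorm f (ENNReal.ofReal p) ν := by
  simp only [eLpNorm_ofReal_eq_lintegral hp, enorm_eq_self, ENNReal.mul_rpow_of_nonneg _ _ hp.le]
  rw [lintegral_const_mul _ (hf.pow_const p), ENNReal.mul_rpow_of_nonneg _ _ (by positivity),
    ← ENNReal.rpow_mul, mul_one_div_cancel hp.ne', ENNReal.rpow_one]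

theorem eLpNorm_rpow_ennreal {s : ℝ} (hp : 0 < p) (hs : 0 < s) (f : α → ℝ≥0∞) :
    eLpNorm (fun a => f a ^ s) (ENNReal.ofReal p) ν =
      eLpNorm f (ENNReal.ofReal (s * p)) ν ^ s := by
  simp only [eLpNorm_ofReal_eq_lintegral hp, eLpNorm_ofReal_eq_lintegral (mul_pos hs hp),
    enorm_eq_self, ← ENNReal.rpow_mul]
  congr 1
  field_simp

/-- Minkowski's inequality for series of non-negative functions. -/
theorem eLpNorm_tsum_ennreal_le (hp : 1 ≤ p) {h : ℕ → α → ℝ≥0∞} (hh : ∀ k, Measurable (h k)) :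
    eLpNorm (fun a => ∑' k, h k a) (ENNReal.ofReal p) ν ≤
      ∑' k, eLpNorm (h k) (ENNReal.ofReal p) ν := by
  have hp0 : 0 < p := one_pos.trans_le hp
  have hfin (n : ℕ) : eLpNorm (fun a => ∑ k ∈ Finset.range n, h k a) (ENNReal.ofReal p) ν ≤
      ∑' k, eLpNorm (h k) (ENNReal.ofReal p) ν := by
    have := eLpNorm_sum_le (f := h) (s := Finset.range n) (μ := ν) (p := ENNReal.ofReal p)
      (fun k _ => (hh k).aestronglyMeasurable) (by simpa using hp)
    refine le_trans (le_of_eq ?_) (this.trans (ENNReal.sum_le_tsum _))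
    congr 1 with a
    simp
  have hmono : Monotone fun n a => (∑ k ∈ Finset.range n, h k a) ^ p := fun m n hmn a =>
    ENNReal.rpow_le_rpow (Finset.sum_le_sum_of_subset (Finset.range_mono hmn)) hp0.le
  simp only [eLpNorm_ofReal_eq_lintegral hp0 (fun a => ∑' k, h k a), enorm_eq_self]
  -- `x ↦ x ^ p` is an order isomorphism of `[0, ∞]`, so it commutes with the supremum of the
  -- partial sums; monotone convergence then applies.
  have hsup (a : α) : (∑' k, h k a) ^ p = ⨆ n, (∑ k ∈ Finset.range n, h k a) ^ p := by
    rw [ENNReal.tsum_eq_iSup_nat]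
    exact (ENNReal.orderIsoRpow p hp0).map_iSup _
  simp only [hsup]
  rw [lintegral_iSup (fun n => (Finset.measurable_fun_sum _ fun k _ => hh k).pow_const p) hmono]
  have : (⨆ n, ∫⁻ a, (∑ k ∈ Finset.range n, h k a) ^ p ∂ν) ^ (1 / p) =
      ⨆ n, (∫⁻ a, (∑ k ∈ Finset.range n, h k a) ^ p ∂ν) ^ (1 / p) :=
    (ENNReal.orderIsoRpow (1 / p) (by positivity)).map_iSup _
  rw [this]
  refine iSup_le fun n => le_trans (le_of_eq ?_) (hfin n)
  simp only [eLpNorm_ofReal_eq_lintegral hp0, enorm_eq_self]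

variable {F : Type*} [NormedAddCommGroup F] {f : ℕ → α → F} {q : ℝ≥0∞} {K : ℝ≥0∞} {c : ℝ≥0}

/-- Telescoping, with the sum bounded by the tail of a geometric series. -/
theorem eLpNorm_sub_le_of_geometric (hf : ∀ n, AEStronglyMeasurable (f n) ν) (hq : 1 ≤ q)
    (h : ∀ n, eLpNorm (fun a => f (n + 1) a - f n a) q ν ≤ K * c ^ n) (n k : ℕ) :
    eLpNorm (fun a => f (n + k) a - f n a) q ν ≤ K * (1 - c : ℝ≥0∞)⁻¹ * c ^ n := by
  have hsum (k : ℕ) : eLpNorm (fun a => f (n + k) a - f n a) q ν ≤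
      ∑ i ∈ Finset.range k, K * (c : ℝ≥0∞) ^ (n + i) := by
    induction k with
    | zero => simp
    | succ k ih =>
      rw [Finset.sum_range_succ, add_comm (∑ _ ∈ _, _)]
      have : (fun a => f (n + (k + 1)) a - f n a) =
          (fun a => f (n + k + 1) a - f (n + k) a) + fun a => f (n + k) a - f n a := by
        ext a
        simp [add_assoc]
      rw [this]
      exact (eLpNorm_add_le ((hf _).sub (hf _)) ((hf _).sub (hf _)) hq).trans
        (add_le_add (h _) ih)
  refine (hsum k).trans ((ENNReal.sum_le_tsum _).trans (le_of_eq ?_))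
  simp_rw [pow_add, ← mul_assoc]
  rw [ENNReal.tsum_mul_left, ENNReal.tsum_geometric]
  ring

/-- Fatou's lemma carries the bound on `f (n + k) - f n`, uniform in `k`, to the limit. -/
theorem eLpNorm_sub_limit_le_of_geometric (hf : ∀ n, AEStronglyMeasurable (f n) ν) (hq : 1 ≤ q)
    (h : ∀ n, eLpNorm (fun a => f (n + 1) a - f n a) q ν ≤ K * c ^ n) {g : α → F}
    (hg : ∀ᵐ a ∂ν, Tendsto (fun n => f n a) atTop (𝓝 (g a))) (n : ℕ) :
    eLpNorm (fun a => f n a - g a) q ν ≤ K * (1 - c : ℝ≥0∞)⁻¹ * c ^ n := by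
  have hneg : eLpNorm (fun a => f n a - g a) q ν = eLpNorm (fun a => g a - f n a) q ν :=
    eLpNorm_sub_comm _ _ _ _
  rw [hneg]
  refine (Lp.eLpNorm_lim_le_liminf_eLpNorm (f := fun k a => f (n + k) a - f n a)
    (fun k => (hf _).sub (hf _)) _ ?_).trans ?_
  · filter_upwards [hg] with a ha
    exact ((tendsto_add_atTop_iff_nat n).2 ha |>.congr fun k => by rw [add_comm]).sub_const _
  · exact liminf_le_of_frequently_le'
      (.of_forall fun k => eLpNorm_sub_le_of_geometric hf hq h n k)

theorem ae_tendsto_of_geometric [CompleteSpace F] (hf : ∀ n, AEStronglyMeasurable (f n) ν)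
    (hq : 1 ≤ q) (hK : K ≠ ∞) (hc : c < 1) (hc0 : 0 < c)
    (h : ∀ n, eLpNorm (fun a => f (n + 1) a - f n a) q ν ≤ K * c ^ n) :
    ∀ᵐ a ∂ν, ∃ l, Tendsto (fun n => f n a) atTop (𝓝 l) := by
  have hc' : (1 - c : ℝ≥0∞)⁻¹ ≠ ∞ := by
    simpa [tsub_eq_zero_iff_le] using hc
  set A := K * (1 - c : ℝ≥0∞)⁻¹ with hA
  have hAtop : A ≠ ∞ := ENNReal.mul_ne_top hK hc'
  -- Two increments from `N` give `2 * A * c ^ N`. The criterion asks for a strict inequality: the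
  -- extra `+ 1` supplies it, as `c ^ N` is positive.
  refine Lp.ae_tendsto_of_cauchy_eLpNorm hf hq (B := fun n => (2 * A + 1) * (c : ℝ≥0∞) ^ n) ?_ ?_
  · rw [ENNReal.tsum_mul_left, ENNReal.tsum_geometric]
    exact ENNReal.mul_ne_top (by finiteness) hc'
  · intro N n m hn hm
    obtain ⟨n, rfl⟩ := Nat.exists_eq_add_of_le hn
    obtain ⟨m, rfl⟩ := Nat.exists_eq_add_of_le hm
    have h1 := eLpNorm_sub_le_of_geometric hf hq h N n
    have h2 := eLpNorm_sub_le_of_geometric hf hq h N m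
    have h3 : eLpNorm (f (N + n) - f (N + m)) q ν ≤ 2 * A * c ^ N := by
      have : f (N + n) - f (N + m) =
          (fun a => f (N + n) a - f N a) - fun a => f (N + m) a - f N a := by
        ext a
        simp
      rw [this, two_mul, add_mul]
      exact (eLpNorm_sub_le ((hf _).sub (hf _)) ((hf _).sub (hf _)) hq).trans (add_le_add h1 h2)
    refine h3.trans_lt ?_
    have hcN : (c : ℝ≥0∞) ^ N ≠ 0 := pow_ne_zero _ (by exact_mod_cast hc0.ne')
    have hcN' : (c : ℝ≥0∞) ^ N ≠ ∞ := by finiteness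
    exact ENNReal.mul_lt_mul_left hcN hcN'
      (ENNReal.lt_add_right (by finiteness) one_ne_zero)

end LpNorms

/-! ### The Picard map and its contraction estimates in `L^p`. -/

section Picard

variable {γ : Type*} [MeasurableSpace γ] {E : Type*} [NormedAddCommGroup E]

/-- The map on functionals of an innovation sequence (newest innovation first) whose fixed points
are the stationary solutions of `Y_t = F(Y_{t-1}, …; X_{t-1}, …; U_t)`,
`X_t = G(X_{t-1}, …; U_t)`. -/
def picardStep (F : (ℕ → ℝ) → (ℕ → E) → γ → ℝ) (G : (ℕ → E) → γ → E) (Φ : (ℕ → γ) → ℝ × E)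
    (u : ℕ → γ) : ℝ × E :=
  (F (fun k => (Φ fun j => u (j + k + 1)).1) (fun k => (Φ fun j => u (j + k + 1)).2) (u 0),
    G (fun k => (Φ fun j => u (j + k + 1)).2) (u 0))

/-- The weighted series `∑ₖ aₖ ρ(u_k, u_{k+1}, …)`. -/
noncomputable def shiftSum (a : ℕ → ℝ≥0∞) (ρ : (ℕ → γ) → ℝ≥0∞) (u : ℕ → γ) : ℝ≥0∞ :=
  ∑' k, a k * ρ fun j => u (j + k)

@[fun_prop]
theorem measurable_shiftSum {a : ℕ → ℝ≥0∞} {ρ : (ℕ → γ) → ℝ≥0∞} (hρ : Measurable ρ) :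
    Measurable (shiftSum a ρ) := by
  unfold shiftSum
  exact Measurable.tsum fun k => (hρ.comp (by fun_prop)).const_mul _

/-- Contraction conditions on the recursion `Y_t = F(Y_{t-1}, …; X_{t-1}, …; U_t)`,
`X_t = G(X_{t-1}, …; U_t)` with innovations of law `μ`. The contraction of the first component is
measured on `ψ(Y_t)` in `L^q`, and it has to control `Y_t` in `L^r` in a Hölder way. -/
structure IsPicardContraction [MeasurableSpace E] (μ : Measure γ)
    (F : (ℕ → ℝ) → (ℕ → E) → γ → ℝ) (G : (ℕ → E) → γ → E) (ψ : ℝ → ℝ) (q r : ℝ)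
    (a b c : ℕ → ℝ≥0∞) : Prop where
  one_le : 1 ≤ q
  le : q ≤ r
  continuous : Continuous ψ
  measurable_fst : Measurable fun p : γ × (ℕ → ℝ) × (ℕ → E) => F p.2.1 p.2.2 p.1
  measurable_snd : Measurable fun p : γ × (ℕ → E) => G p.2 p.1
  snd_le : ∀ x x', eLpNorm (fun u => G x u - G x' u) (ENNReal.ofReal r) μ ≤
    ∑' k, a k * ‖x k - x' k‖ₑ
  comp_fst_le : ∀ y y' x x',
    eLpNorm (fun u => ψ (F y x u) - ψ (F y' x' u)) (ENNReal.ofReal q) μ ≤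
      (∑' k, b k * ‖ψ (y k) - ψ (y' k)‖ₑ) + ∑' k, c k * ‖x k - x' k‖ₑ
  fst_le : ∀ y y' x x',
    eLpNorm (fun u => F y x u - F y' x' u) (ENNReal.ofReal r) μ ≤
      ((∑' k, b k * ‖ψ (y k) - ψ (y' k)‖ₑ) + ∑' k, c k * ‖x k - x' k‖ₑ) ^ (q / r)
  tsum_snd_lt_one : ∑' k, a k < 1
  tsum_fst_lt_one : ∑' k, b k < 1
  tsum_ne_top : ∑' k, c k ≠ ∞
  snd_zero : eLpNorm (G 0) (ENNReal.ofReal r) μ ≠ ∞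
  comp_fst_zero : eLpNorm (fun u => ψ (F 0 0 u) - ψ 0) (ENNReal.ofReal q) μ ≠ ∞
  fst_zero : eLpNorm (F 0 0) (ENNReal.ofReal r) μ ≠ ∞

namespace IsPicardContraction

variable [MeasurableSpace E] {μ : Measure γ}
  {F : (ℕ → ℝ) → (ℕ → E) → γ → ℝ} {G : (ℕ → E) → γ → E} {ψ : ℝ → ℝ} {q r : ℝ}
  {a b c : ℕ → ℝ≥0∞}

theorem one_le_r (h : IsPicardContraction μ F G ψ q r a b c) : 1 ≤ r := h.one_le.trans h.le

theorem measurable_picardStep (h : IsPicardContraction μ F G ψ q r a b c)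
    {Φ : (ℕ → γ) → ℝ × E} (hΦ : Measurable Φ) : Measurable (picardStep F G Φ) := by
  have h1 : Measurable fun u : ℕ → γ => fun k => (Φ fun j => u (j + k + 1)).1 :=
    measurable_pi_lambda _ fun k => hΦ.fst.comp (by fun_prop)
  have h2 : Measurable fun u : ℕ → γ => fun k => (Φ fun j => u (j + k + 1)).2 :=
    measurable_pi_lambda _ fun k => hΦ.snd.comp (by fun_prop)
  exact (h.measurable_fst.comp ((measurable_pi_apply 0).prodMk (h1.prodMk h2))).prodMk
    (h.measurable_snd.comp ((measurable_pi_apply 0).prodMk h2))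

theorem measurable_fst_past (h : IsPicardContraction μ F G ψ q r a b c) {Φ : (ℕ → γ) → ℝ × E}
    (hΦ : Measurable Φ) :
    Measurable fun p : γ × (ℕ → γ) =>
      F (fun k => (Φ fun j => p.2 (j + k)).1) (fun k => (Φ fun j => p.2 (j + k)).2) p.1 := by
  have h1 : Measurable fun v : ℕ → γ => fun k => (Φ fun j => v (j + k)).1 :=
    measurable_pi_lambda _ fun k => hΦ.fst.comp (by fun_prop)
  have h2 : Measurable fun v : ℕ → γ => fun k => (Φ fun j => v (j + k)).2 :=
    measurable_pi_lambda _ fun k => hΦ.snd.comp (by fun_prop)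
  exact h.measurable_fst.comp (_root_.measurable_fst.prodMk
    ((h1.comp _root_.measurable_snd).prodMk (h2.comp _root_.measurable_snd)))

end IsPicardContraction

variable {μ : Measure γ} [IsProbabilityMeasure μ]

local notation "Q" => Measure.infinitePi fun _ : ℕ => μ

/-- Minkowski, and shift invariance of the product measure: all shifted copies of `ρ` have the same
norm. -/
theorem eLpNorm_shiftSum_le {p : ℝ} (hp : 1 ≤ p) (a : ℕ → ℝ≥0∞) {ρ : (ℕ → γ) → ℝ≥0∞}
    (hρ : Measurable ρ) :
    eLpNorm (shiftSum a ρ) (ENNReal.ofReal p) Q ≤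
      (∑' k, a k) * eLpNorm ρ (ENNReal.ofReal p) Q := by
  have hm (k : ℕ) : Measurable fun u : ℕ → γ => ρ fun j => u (j + k) := hρ.comp (by fun_prop)
  refine (eLpNorm_tsum_ennreal_le hp fun k => (hm k).const_mul (a k)).trans (le_of_eq ?_)
  rw [← ENNReal.tsum_mul_right]
  refine tsum_congr fun k => ?_
  rw [eLpNorm_const_mul_ennreal (one_pos.trans_le hp) _ (hm k)]
  congr 1
  exact eLpNorm_comp_measurePreserving (g := ρ) hρ.aestronglyMeasurable
    (measurePreserving_reindex_infinitePi μ (add_left_injective k))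

/-- Passes from frozen to random pasts: the newest innovation is independent of the others, so
Fubini integrates the bound at each fixed past `v`. -/
theorem eLpNorm_head_tail_le {H : Type*} [NormedAddCommGroup H] [MeasurableSpace H]
    [OpensMeasurableSpace H] {p : ℝ} (hp : 0 < p) {h : γ → (ℕ → γ) → H}
    (hh : Measurable fun q : γ × (ℕ → γ) => h q.1 q.2) {L : (ℕ → γ) → ℝ≥0∞}
    (hL : ∀ v, eLpNorm (fun a => h a v) (ENNReal.ofReal p) μ ≤ L v) :
    eLpNorm (fun u => h (u 0) fun k => u (k + 1)) (ENNReal.ofReal p) Q ≤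
      eLpNorm L (ENNReal.ofReal p) Q := by
  rw [eLpNorm_ofReal_eq_lintegral hp, eLpNorm_ofReal_eq_lintegral hp]
  refine ENNReal.rpow_le_rpow ?_ (by positivity)
  have hm : Measurable fun q : γ × (ℕ → γ) => ‖h q.1 q.2‖ₑ ^ p := hh.enorm.pow_const p
  have := (measurePreserving_head_tail μ).lintegral_comp hm
  rw [this, lintegral_prod_symm' _ hm]
  refine lintegral_mono fun v => ?_
  have hv := hL v
  rw [eLpNorm_ofReal_eq_lintegral hp, one_div, ENNReal.rpow_inv_le_iff hp] at hv
  simpa using hv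

namespace IsPicardContraction

variable [MeasurableSpace E] [BorelSpace E] [SecondCountableTopology E]
  {F : (ℕ → ℝ) → (ℕ → E) → γ → ℝ} {G : (ℕ → E) → γ → E} {ψ : ℝ → ℝ} {q r : ℝ}
  {a b c : ℕ → ℝ≥0∞}

variable {Φ Φ' : (ℕ → γ) → ℝ × E}

theorem eLpNorm_snd_picardStep_sub_le (h : IsPicardContraction μ F G ψ q r a b c)
    (hΦ : Measurable Φ) (hΦ' : Measurable Φ') :
    eLpNorm (fun u => (picardStep F G Φ u).2 - (picardStep F G Φ' u).2) (ENNReal.ofReal r) Q ≤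
      (∑' k, a k) * eLpNorm (fun u => (Φ u).2 - (Φ' u).2) (ENNReal.ofReal r) Q := by
  have hs {Ψ : (ℕ → γ) → ℝ × E} (hΨ : Measurable Ψ) :
      Measurable fun v : ℕ → γ => fun k => (Ψ fun j => v (j + k)).2 :=
    measurable_pi_lambda _ fun k => hΨ.snd.comp (by fun_prop)
  have hm {Ψ : (ℕ → γ) → ℝ × E} (hΨ : Measurable Ψ) : Measurable fun p : γ × (ℕ → γ) =>
      G (fun k => (Ψ fun j => p.2 (j + k)).2) p.1 :=
    h.measurable_snd.comp (_root_.measurable_fst.prodMk ((hs hΨ).comp _root_.measurable_snd))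
  have h1 := eLpNorm_head_tail_le (μ := μ) (one_pos.trans_le h.one_le_r)
    (h := fun u v => G (fun k => (Φ fun j => v (j + k)).2) u -
      G (fun k => (Φ' fun j => v (j + k)).2) u)
    ((hm hΦ).sub (hm hΦ'))
    (L := shiftSum a fun u => ‖(Φ u).2 - (Φ' u).2‖ₑ) fun v => h.snd_le _ _
  refine h1.trans ((eLpNorm_shiftSum_le h.one_le_r a (hΦ.snd.sub hΦ'.snd).enorm).trans ?_)
  rw [eLpNorm_enorm]
  exact le_rfl

/-- The Lipschitz bound for the first component, as a function of the past. -/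
noncomputable def fstBound (ψ : ℝ → ℝ) (b c : ℕ → ℝ≥0∞) (Φ Φ' : (ℕ → γ) → ℝ × E) :
    (ℕ → γ) → ℝ≥0∞ :=
  shiftSum b (fun u => ‖ψ (Φ u).1 - ψ (Φ' u).1‖ₑ) + shiftSum c (fun u => ‖(Φ u).2 - (Φ' u).2‖ₑ)

theorem eLpNorm_fstBound_le (h : IsPicardContraction μ F G ψ q r a b c)
    (hΦ : Measurable Φ) (hΦ' : Measurable Φ') :
    eLpNorm (fstBound ψ b c Φ Φ') (ENNReal.ofReal q) Q ≤
      (∑' k, b k) * eLpNorm (fun u => ψ (Φ u).1 - ψ (Φ' u).1) (ENNReal.ofReal q) Q +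
      (∑' k, c k) * eLpNorm (fun u => (Φ u).2 - (Φ' u).2) (ENNReal.ofReal r) Q := by
  have hψ := h.continuous.measurable
  have h1 : Measurable fun u => ‖ψ (Φ u).1 - ψ (Φ' u).1‖ₑ :=
    ((hψ.comp hΦ.fst).sub (hψ.comp hΦ'.fst)).enorm
  have h2 : Measurable fun u => (Φ u).2 - (Φ' u).2 := hΦ.snd.sub hΦ'.snd
  refine (eLpNorm_add_le (measurable_shiftSum h1).aestronglyMeasurable
    (measurable_shiftSum h2.enorm).aestronglyMeasurable (by simpa using h.one_le)).trans
    (add_le_add ((eLpNorm_shiftSum_le h.one_le b h1).trans (by rw [eLpNorm_enorm])) ?_)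
  refine (eLpNorm_shiftSum_le h.one_le c h2.enorm).trans ?_
  rw [eLpNorm_enorm]
  gcongr
  -- On a probability space the `L^q` norm is at most the `L^r` norm when `q ≤ r`.
  exact eLpNorm_le_eLpNorm_of_exponent_le (ENNReal.ofReal_le_ofReal h.le) h2.aestronglyMeasurable

theorem eLpNorm_comp_fst_picardStep_sub_le (h : IsPicardContraction μ F G ψ q r a b c)
    (hΦ : Measurable Φ) (hΦ' : Measurable Φ') :
    eLpNorm (fun u => ψ (picardStep F G Φ u).1 - ψ (picardStep F G Φ' u).1)
        (ENNReal.ofReal q) Q ≤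
      (∑' k, b k) * eLpNorm (fun u => ψ (Φ u).1 - ψ (Φ' u).1) (ENNReal.ofReal q) Q +
      (∑' k, c k) * eLpNorm (fun u => (Φ u).2 - (Φ' u).2) (ENNReal.ofReal r) Q := by
  have hψ := h.continuous.measurable
  exact (eLpNorm_head_tail_le (μ := μ) (one_pos.trans_le h.one_le)
    (h := fun u v => ψ (F (fun k => (Φ fun j => v (j + k)).1) (fun k => (Φ fun j => v (j + k)).2) u)
      - ψ (F (fun k => (Φ' fun j => v (j + k)).1) (fun k => (Φ' fun j => v (j + k)).2) u))
    ((hψ.comp (h.measurable_fst_past hΦ)).sub (hψ.comp (h.measurable_fst_past hΦ')))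
    (L := fstBound ψ b c Φ Φ') fun v => h.comp_fst_le _ _ _ _).trans
    (h.eLpNorm_fstBound_le hΦ hΦ')

theorem eLpNorm_fst_picardStep_sub_le (h : IsPicardContraction μ F G ψ q r a b c)
    (hΦ : Measurable Φ) (hΦ' : Measurable Φ') :
    eLpNorm (fun u => (picardStep F G Φ u).1 - (picardStep F G Φ' u).1) (ENNReal.ofReal r) Q ≤
      ((∑' k, b k) * eLpNorm (fun u => ψ (Φ u).1 - ψ (Φ' u).1) (ENNReal.ofReal q) Q +
      (∑' k, c k) * eLpNorm (fun u => (Φ u).2 - (Φ' u).2) (ENNReal.ofReal r) Q) ^ (q / r) := by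
  have hr : 0 < r := one_pos.trans_le h.one_le_r
  have hq : 0 < q := one_pos.trans_le h.one_le
  refine (eLpNorm_head_tail_le (μ := μ) hr
    (h := fun u v => F (fun k => (Φ fun j => v (j + k)).1) (fun k => (Φ fun j => v (j + k)).2) u
      - F (fun k => (Φ' fun j => v (j + k)).1) (fun k => (Φ' fun j => v (j + k)).2) u)
    ((h.measurable_fst_past hΦ).sub (h.measurable_fst_past hΦ'))
    (L := fun v => fstBound ψ b c Φ Φ' v ^ (q / r)) fun v => h.fst_le _ _ _ _).trans ?_
  -- The `L^r` norm of a power `q / r` is the power `q / r` of the `L^q` norm, where the linear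
  -- bound lives.
  rw [eLpNorm_rpow_ennreal hr (by positivity), div_mul_cancel₀ _ hr.ne']
  exact ENNReal.rpow_le_rpow (h.eLpNorm_fstBound_le hΦ hΦ') (by positivity)

end IsPicardContraction

/-- A geometric bound for solutions of a triangular system of linear recursive inequalities. -/
theorem exists_geometric_bound {a b c : ℝ≥0∞} (ha : a < 1) (hb : b < 1) (hc : c ≠ ∞)
    {D e : ℕ → ℝ≥0∞} (hD : D 0 ≠ ∞) (he : e 0 ≠ ∞) (hes : ∀ n, e (n + 1) ≤ a * e n)
    (hDs : ∀ n, D (n + 1) ≤ b * D n + c * e n) :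
    ∃ (K : ℝ≥0∞) (ρ : ℝ≥0), K ≠ ∞ ∧ 0 < ρ ∧ ρ < 1 ∧
      ∀ n, e n ≤ K * ρ ^ n ∧ D n ≤ K * ρ ^ n := by
  -- The rate is taken strictly above `b`, so that the gap `ρ - b` absorbs the forcing term `c * e
  -- n`, even when `a = b`.
  obtain ⟨ρ, hρ, hρ1⟩ := ENNReal.lt_iff_exists_nnreal_btwn.1 (max_lt ha hb)
  have haρ : a ≤ ρ := (le_max_left _ _).trans hρ.le
  have hbρ : b < ρ := (le_max_right _ _).trans_lt hρ
  have hgap : (ρ - b : ℝ≥0∞) ≠ 0 := (tsub_pos_of_lt hbρ).ne'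
  have hgap' : (ρ - b : ℝ≥0∞) ≠ ∞ := by finiteness
  have hρ0 : 0 < ρ := by exact_mod_cast (zero_le (a := b)).trans_lt hbρ
  have hen (n : ℕ) : e n ≤ e 0 * ρ ^ n := by
    induction n with
    | zero => simp
    | succ n ih =>
      calc e (n + 1) ≤ ρ * (e 0 * ρ ^ n) := (hes n).trans (mul_le_mul' haρ ih)
        _ = _ := by ring
  -- Chosen so that `D 0 ≤ K` and `b * K + c * e 0 ≤ ρ * K`, which closes the induction.
  set K := D 0 + c * e 0 / (ρ - b) with hK
  have hKtop : K ≠ ∞ := by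
    refine ENNReal.add_ne_top.2 ⟨hD, ENNReal.div_ne_top (ENNReal.mul_ne_top hc he) hgap⟩
  have hKb : b * K + c * e 0 ≤ ρ * K := by
    have : c * e 0 ≤ (ρ - b) * K := by
      rw [hK, mul_add, ENNReal.mul_div_cancel hgap hgap']
      exact le_add_self
    calc b * K + c * e 0 ≤ b * K + (ρ - b) * K := by gcongr
      _ = ρ * K := by rw [← add_mul, add_tsub_cancel_of_le hbρ.le]
  have hDn (n : ℕ) : D n ≤ K * ρ ^ n := by
    induction n with
    | zero => simp [hK]
    | succ n ih =>
      calc D (n + 1) ≤ b * (K * ρ ^ n) + c * (e 0 * ρ ^ n) :=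
            (hDs n).trans (by gcongr; exact hen n)
        _ = (b * K + c * e 0) * ρ ^ n := by ring
        _ ≤ (ρ * K) * ρ ^ n := by gcongr
        _ = _ := by ring
  exact ⟨K + e 0, ρ, by finiteness, hρ0, by exact_mod_cast hρ1, fun n =>
    ⟨(hen n).trans (by gcongr; exact le_add_self), (hDn n).trans (by gcongr; exact le_self_add)⟩⟩

end Picard

/-! ### Convergence of the Picard iterates to a fixed point. -/

theorem tendsto_geometric_bound {C : ℝ≥0∞} {θ : ℝ≥0} (hC : C ≠ ∞) (hθ : θ < 1) :
    Tendsto (fun n : ℕ => C * (1 - θ : ℝ≥0∞)⁻¹ * (θ : ℝ≥0∞) ^ n) atTop (𝓝 0) := by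
  have hθ' : (1 - θ : ℝ≥0∞)⁻¹ ≠ ∞ := by simpa [tsub_eq_zero_iff_le] using hθ
  have := ENNReal.Tendsto.const_mul (ENNReal.tendsto_pow_atTop_nhds_zero_of_lt_one
    (show (θ : ℝ≥0∞) < 1 by exact_mod_cast hθ)) (.inr (ENNReal.mul_ne_top hC hθ'))
  simpa using this

theorem tendsto_zero_of_le {s t : ℕ → ℝ≥0∞} (ht : Tendsto t atTop (𝓝 0)) (hst : ∀ n, s n ≤ t n) :
    Tendsto s atTop (𝓝 0) :=
  tendsto_of_tendsto_of_tendsto_of_le_of_le tendsto_const_nhds ht (fun _ => zero_le) hst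

theorem ae_eq_of_tendsto_eLpNorm_sub {α H : Type*} [MeasurableSpace α] {ν : Measure α}
    [NormedAddCommGroup H] {p : ℝ≥0∞} (hp : 1 ≤ p) {s : ℕ → α → H} {v w : α → H}
    (hsm : ∀ n, AEStronglyMeasurable (s n) ν) (hvm : AEStronglyMeasurable v ν)
    (hwm : AEStronglyMeasurable w ν)
    (hv : Tendsto (fun n => eLpNorm (fun u => s n u - v u) p ν) atTop (𝓝 0))
    (hw : Tendsto (fun n => eLpNorm (fun u => s n u - w u) p ν) atTop (𝓝 0)) :
    v =ᵐ[ν] w := by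
  have hsum := hv.add hw
  rw [add_zero] at hsum
  have hle (n : ℕ) : eLpNorm (v - w) p ν ≤
      eLpNorm (fun u => s n u - v u) p ν + eLpNorm (fun u => s n u - w u) p ν := by
    have : v - w = (fun u => s n u - w u) - fun u => s n u - v u := by
      ext u
      simp
    rw [this, add_comm]
    exact eLpNorm_sub_le ((hsm n).sub hwm) ((hsm n).sub hvm) hp
  have hz : eLpNorm (v - w) p ν = 0 := le_antisymm (ge_of_tendsto' hsum hle) zero_le
  rw [eLpNorm_eq_zero_iff (hvm.sub hwm) (one_pos.trans_le hp).ne'] at hz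
  filter_upwards [hz] with u hu
  exact sub_eq_zero.1 hu

section FixedPoint

variable {γ : Type*} [MeasurableSpace γ] {E : Type*} [NormedAddCommGroup E] [CompleteSpace E]
  [MeasurableSpace E] [BorelSpace E] [SecondCountableTopology E]
  {μ : Measure γ} [IsProbabilityMeasure μ]
  {F : (ℕ → ℝ) → (ℕ → E) → γ → ℝ} {G : (ℕ → E) → γ → E} {ψ : ℝ → ℝ} {q r : ℝ}
  {a b c : ℕ → ℝ≥0∞}

local notation "Q" => Measure.infinitePi fun _ : ℕ => μ

theorem eLpNorm_comp_eval_zero {H : Type*} [NormedAddCommGroup H] [MeasurableSpace H]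
    [BorelSpace H] [SecondCountableTopology H] {f : γ → H} (hf : Measurable f) (p : ℝ≥0∞) :
    eLpNorm (fun u : ℕ → γ => f (u 0)) p Q = eLpNorm f p μ :=
  eLpNorm_comp_measurePreserving (g := f) hf.aestronglyMeasurable
    (measurePreserving_eval_infinitePi (fun _ => μ) 0)

/-- The Picard iterates converge to a stationary solution, as a functional of the innovations. -/
theorem IsPicardContraction.exists_fixedPoint (h : IsPicardContraction μ F G ψ q r a b c) :
    ∃ Φ : (ℕ → γ) → ℝ × E, Measurable Φ ∧ MemLp Φ (ENNReal.ofReal r) Q ∧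
      ∀ᵐ u ∂Q, Φ u = picardStep F G Φ u := by
  set f : ℕ → (ℕ → γ) → ℝ × E := fun n => (picardStep F G)^[n] 0 with hf
  have hf0 : f 0 = 0 := rfl
  have hfs (n : ℕ) : f (n + 1) = picardStep F G (f n) := Function.iterate_succ_apply' _ _ _
  have hfm (n : ℕ) : Measurable (f n) := by
    induction n with
    | zero => exact measurable_const
    | succ n ih => rw [hfs]; exact h.measurable_picardStep ih
  have hψ := h.continuous.measurable
  have hq : 1 ≤ ENNReal.ofReal q := by simpa using h.one_le
  have hr : 1 ≤ ENNReal.ofReal r := by simpa using h.one_le_r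
  have hr0 : 0 < r := one_pos.trans_le h.one_le_r
  have hs0 : 0 < q / r := div_pos (one_pos.trans_le h.one_le) hr0
  set e : ℕ → ℝ≥0∞ := fun n =>
    eLpNorm (fun u => (f (n + 1) u).2 - (f n u).2) (ENNReal.ofReal r) Q with he
  set D : ℕ → ℝ≥0∞ := fun n =>
    eLpNorm (fun u => ψ (f (n + 1) u).1 - ψ (f n u).1) (ENNReal.ofReal q) Q with hD
  have hGm : Measurable (G 0) := h.measurable_snd.comp
    (measurable_id.prodMk (measurable_const (a := (0 : ℕ → E))))
  have hFm : Measurable (F 0 0) := h.measurable_fst.comp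
    (measurable_id.prodMk (measurable_const (a := ((0 : ℕ → ℝ), (0 : ℕ → E)))))
  have he0 : e 0 ≠ ∞ := by
    have : e 0 = eLpNorm (G 0) (ENNReal.ofReal r) μ := by
      rw [← eLpNorm_comp_eval_zero hGm]
      simp only [he, hfs, hf0, picardStep, Pi.zero_apply, Prod.snd_zero, sub_zero]
      rfl
    rw [this]
    exact h.snd_zero
  have hD0 : D 0 ≠ ∞ := by
    have : D 0 = eLpNorm (fun u => ψ (F 0 0 u) - ψ 0) (ENNReal.ofReal q) μ := by
      rw [← eLpNorm_comp_eval_zero (f := fun u => ψ (F 0 0 u) - ψ 0) ((hψ.comp hFm).sub_const _)]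
      simp only [hD, hfs, hf0, picardStep, Pi.zero_apply, Prod.fst_zero, Prod.snd_zero]
      rfl
    rw [this]
    exact h.comp_fst_zero
  have hB0 : eLpNorm (fun u => (f 1 u).1 - (f 0 u).1) (ENNReal.ofReal r) Q ≠ ∞ := by
    have : eLpNorm (fun u => (f 1 u).1 - (f 0 u).1) (ENNReal.ofReal r) Q =
        eLpNorm (F 0 0) (ENNReal.ofReal r) μ := by
      rw [← eLpNorm_comp_eval_zero hFm]
      simp only [hfs, hf0, picardStep, Pi.zero_apply, Prod.fst_zero, Prod.snd_zero, sub_zero]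
      rfl
    rw [this]
    exact h.fst_zero
  obtain ⟨K, ρ, hK, hρ0, hρ1, hKρ⟩ := exists_geometric_bound h.tsum_snd_lt_one h.tsum_fst_lt_one
    h.tsum_ne_top hD0 he0
    (fun n => by simp only [he, hfs]; exact h.eLpNorm_snd_picardStep_sub_le (by
      rw [← hfs]; exact hfm _) (hfm _))
    (fun n => by simp only [hD, he, hfs]; exact h.eLpNorm_comp_fst_picardStep_sub_le (by
      rw [← hfs]; exact hfm _) (hfm _))
  -- the increments of the first component decay geometrically in `L^r`
  set A := (∑' k, b k) * K + (∑' k, c k) * K with hA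
  have hAtop : A ≠ ∞ := ENNReal.add_ne_top.2 ⟨ENNReal.mul_ne_top h.tsum_fst_lt_one.ne_top hK,
    ENNReal.mul_ne_top h.tsum_ne_top hK⟩
  set σ : ℝ≥0 := ρ ^ (q / r) with hσ
  have hσ0 : 0 < σ := NNReal.rpow_pos hρ0
  have hσ1 : σ < 1 := NNReal.rpow_lt_one hρ1 hs0
  -- The Hölder estimate bounds an increment of `Y` by the preceding increments of `ψ(Y)` and `X`,
  -- so these bounds start at the first iterate; hence the shift of index for `Y` below.
  have hBn (n : ℕ) : eLpNorm (fun u => (f (n + 2) u).1 - (f (n + 1) u).1) (ENNReal.ofReal r) Q ≤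
      A ^ (q / r) * σ ^ n := by
    have h1 := h.eLpNorm_fst_picardStep_sub_le (hfm (n + 1)) (hfm n)
    rw [← hfs, ← hfs] at h1
    refine h1.trans ?_
    have h2 : (A * (ρ : ℝ≥0∞) ^ n) ^ (q / r) = A ^ (q / r) * (σ : ℝ≥0∞) ^ n := by
      rw [ENNReal.mul_rpow_of_nonneg _ _ hs0.le, hσ, ENNReal.coe_rpow_of_nonneg _ hs0.le,
        ← ENNReal.rpow_natCast, ← ENNReal.rpow_natCast, ← ENNReal.rpow_mul, ← ENNReal.rpow_mul,
        mul_comm (n : ℝ)]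
    rw [← h2]
    refine ENNReal.rpow_le_rpow ?_ hs0.le
    rw [hA, add_mul, mul_assoc, mul_assoc]
    exact add_le_add (mul_le_mul_right (hKρ n).2 _) (mul_le_mul_right (hKρ n).1 _)
  have hm1 (n : ℕ) : AEStronglyMeasurable (fun u => (f n u).1) Q := (hfm n).fst.aestronglyMeasurable
  have hm2 (n : ℕ) : AEStronglyMeasurable (fun u => (f n u).2) Q := (hfm n).snd.aestronglyMeasurable
  have hm3 (n : ℕ) : AEStronglyMeasurable (fun u => ψ (f n u).1) Q :=
    (hψ.comp (hfm n).fst).aestronglyMeasurable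
  obtain ⟨Y, hYm, hY⟩ := exists_stronglyMeasurable_limit_of_tendsto_ae (fun n => hm1 (n + 1))
    (ae_tendsto_of_geometric (f := fun n u => (f (n + 1) u).1) (fun n => hm1 (n + 1)) hr
      (ENNReal.rpow_ne_top_of_nonneg hs0.le hAtop) hσ1 hσ0 hBn)
  obtain ⟨X, hXm, hX⟩ := exists_stronglyMeasurable_limit_of_tendsto_ae hm2
    (ae_tendsto_of_geometric (f := fun n u => (f n u).2) hm2 hr hK hρ1 hρ0 fun n => (hKρ n).1)
  -- Continuity of `ψ` identifies the limit of `ψ` of the iterates as `ψ (Y u)`; the `L^q` rate then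
  -- comes from the geometric increments.
  have hYψ : ∀ᵐ u ∂Q, Tendsto (fun n => ψ (f n u).1) atTop (𝓝 (ψ (Y u))) := by
    filter_upwards [hY] with u hu
    exact (h.continuous.tendsto _).comp ((tendsto_add_atTop_iff_nat 1).1 hu)
  have hYlim := eLpNorm_sub_limit_le_of_geometric (f := fun n u => (f (n + 1) u).1)
    (fun n => hm1 (n + 1)) hr hBn hY
  have hXlim := eLpNorm_sub_limit_le_of_geometric (f := fun n u => (f n u).2) hm2 hr
    (fun n => (hKρ n).1) hX
  have hψlim := eLpNorm_sub_limit_le_of_geometric (f := fun n u => ψ (f n u).1) hm3 hq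
    (fun n => (hKρ n).2) hYψ
  have hYt := tendsto_zero_of_le (tendsto_geometric_bound (ENNReal.rpow_ne_top_of_nonneg hs0.le hAtop) hσ1) hYlim
  have hXt := tendsto_zero_of_le (tendsto_geometric_bound hK hρ1) hXlim
  have hψt := tendsto_zero_of_le (tendsto_geometric_bound hK hρ1) hψlim
  set Φ : (ℕ → γ) → ℝ × E := fun u => (Y u, X u) with hΦ
  have hΦm : Measurable Φ := hYm.measurable.prodMk hXm.measurable
  have hlim : Tendsto (fun n => (∑' k, b k) *
      eLpNorm (fun u => ψ (f n u).1 - ψ (Φ u).1) (ENNReal.ofReal q) Q +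
      (∑' k, c k) * eLpNorm (fun u => (f n u).2 - (Φ u).2) (ENNReal.ofReal r) Q)
      atTop (𝓝 0) := by
    simpa using (ENNReal.Tendsto.const_mul hψt (.inr h.tsum_fst_lt_one.ne_top)).add
      (ENNReal.Tendsto.const_mul hXt (.inr h.tsum_ne_top))
  -- The same iterates also converge to `picardStep F G Φ`, by the contraction estimates between `f
  -- n` and `Φ`. Uniqueness of limits in `L^r` then gives the fixed point.
  have hY' : Tendsto (fun n => eLpNorm (fun u => (f (n + 1) u).1 - (picardStep F G Φ u).1)
      (ENNReal.ofReal r) Q) atTop (𝓝 0) := by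
    refine tendsto_zero_of_le (t := fun n => ((∑' k, b k) *
      eLpNorm (fun u => ψ (f n u).1 - ψ (Φ u).1) (ENNReal.ofReal q) Q +
      (∑' k, c k) * eLpNorm (fun u => (f n u).2 - (Φ u).2) (ENNReal.ofReal r) Q) ^ (q / r)) ?_
      fun n => by rw [hfs]; exact h.eLpNorm_fst_picardStep_sub_le (hfm n) hΦm
    have := (ENNReal.continuous_rpow_const (y := q / r)).tendsto 0
    rw [ENNReal.zero_rpow_of_pos hs0] at this
    exact this.comp hlim
  have hX' : Tendsto (fun n => eLpNorm (fun u => (f (n + 1) u).2 - (picardStep F G Φ u).2)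
      (ENNReal.ofReal r) Q) atTop (𝓝 0) := by
    refine tendsto_zero_of_le (t := fun n => (∑' k, a k) *
      eLpNorm (fun u => (f n u).2 - (Φ u).2) (ENNReal.ofReal r) Q) ?_
      fun n => by rw [hfs]; exact h.eLpNorm_snd_picardStep_sub_le (hfm n) hΦm
    simpa using ENNReal.Tendsto.const_mul hXt (.inr h.tsum_snd_lt_one.ne_top)
  have hΦs := h.measurable_picardStep hΦm
  have e1 := ae_eq_of_tendsto_eLpNorm_sub hr (fun n => hm1 (n + 1)) hYm.aestronglyMeasurable
    hΦs.fst.aestronglyMeasurable hYt hY'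
  have e2 := ae_eq_of_tendsto_eLpNorm_sub hr (fun n => hm2 (n + 1)) hXm.aestronglyMeasurable
    hΦs.snd.aestronglyMeasurable ((tendsto_add_atTop_iff_nat 1).2 hXt) hX'
  refine ⟨Φ, hΦm, ?_, ?_⟩
  -- Since `f 0 = 0`, the limit bound at `n = 0` is already a norm bound on `X`. For `Y` the bounds
  -- start at `f 1`, whose first component `F 0 0` lies in `L^r`.
  · have hfin {θ : ℝ≥0} (hθ : θ < 1) : (1 - θ : ℝ≥0∞)⁻¹ ≠ ∞ := by
      simpa [tsub_eq_zero_iff_le] using hθ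
    have hX0 : MemLp X (ENNReal.ofReal r) Q := by
      refine ⟨hXm.aestronglyMeasurable, ?_⟩
      have := hXlim 0
      simp only [hf0, Pi.zero_apply, Prod.snd_zero, zero_sub, pow_zero, mul_one] at this
      have h' : eLpNorm (fun u => -X u) (ENNReal.ofReal r) Q = eLpNorm X (ENNReal.ofReal r) Q :=
        eLpNorm_neg _ _ _
      rw [h'] at this
      exact this.trans_lt (ENNReal.mul_ne_top hK (hfin hρ1)).lt_top
    have hY0 : MemLp Y (ENNReal.ofReal r) Q := by
      have h1 : MemLp (fun u => (f 1 u).1) (ENNReal.ofReal r) Q := by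
        refine ⟨hm1 1, ?_⟩
        simpa [hf0] using hB0.lt_top
      have h2 : MemLp (fun u => (f 1 u).1 - Y u) (ENNReal.ofReal r) Q :=
        ⟨(hm1 1).sub hYm.aestronglyMeasurable, (hYlim 0).trans_lt (by
          rw [pow_zero, mul_one]
          exact (ENNReal.mul_ne_top (ENNReal.rpow_ne_top_of_nonneg hs0.le hAtop)
            (hfin hσ1)).lt_top)⟩
      have := h1.sub h2
      rwa [show ((fun u => (f 1 u).1) - fun u => (f 1 u).1 - Y u) = Y by ext u; simp] at this
    exact MemLp.of_fst_snd ⟨hY0, hX0⟩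
  · filter_upwards [e1, e2] with u h1 h2
    exact Prod.ext h1 h2

end FixedPoint

/-! ### Stationarity, ergodicity and weak dependence of functionals of i.i.d. innovations. -/

section BernoulliFunctionals

/-- The path of a two-sided process obtained by applying a functional to the past innovations. -/
def pathMap {γ β : Type*} (Φ : (ℕ → γ) → β) (u : ℤ → γ) (t : ℤ) : β := Φ fun k => u (t - k)

/-- This equivariance is what carries stationarity and ergodicity from the innovations to the
process. -/
theorem pathMap_shift {γ β : Type*} (Φ : (ℕ → γ) → β) (u : ℤ → γ) (h : ℤ) :
    pathMap Φ (fun t => u (t + h)) = fun t => pathMap Φ u (t + h) := by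
  funext t
  simp only [pathMap]
  congr 1 with k
  congr 1
  ring

variable {Ω γ : Type*} [MeasurableSpace Ω] [MeasurableSpace γ] {P : Measure Ω}
  {U : ℤ → Ω → γ}

theorem measurePreserving_iid_reindex {κ : Type*} [Countable κ] (hU : ∀ t, Measurable (U t))
    (hind : iIndepFun U P) (hid : ∀ t, IdentDistrib (U t) (U 0) P P) {e : κ → ℤ}
    (he : e.Injective) :
    MeasurePreserving (fun ω k => U (e k) ω) P (Measure.infinitePi fun _ => P.map (U 0)) := by
  refine ⟨measurable_pi_lambda _ fun k => hU _, ?_⟩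
  rw [(hind.precomp he).map_fun_eq_infinitePi_map fun k => hU _]
  congr 1 with k : 1
  exact (hid _).map_eq

variable {β : Type*} [MeasurableSpace β]

theorem measurable_pathMap {Φ : (ℕ → γ) → β} (hΦ : Measurable Φ) : Measurable (pathMap Φ) :=
  measurable_pi_lambda _ fun _ => hΦ.comp (by fun_prop)

theorem measurePreserving_pathMap {Φ : (ℕ → γ) → β} (hΦ : Measurable Φ)
    (hU : ∀ t, Measurable (U t)) (hind : iIndepFun U P)
    (hid : ∀ t, IdentDistrib (U t) (U 0) P P) :
    MeasurePreserving (pathMap Φ) (Measure.infinitePi fun _ : ℤ => P.map (U 0))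
      (P.map fun ω t => Φ fun k => U (t - k) ω) := by
  have hmp := measurePreserving_iid_reindex hU hind hid (e := (id : ℤ → ℤ)) Function.injective_id
  refine ⟨measurable_pathMap hΦ, ?_⟩
  rw [← hmp.map_eq, Measure.map_map (measurable_pathMap hΦ) hmp.measurable]
  rfl

theorem strictlyStationary_of_iid {Φ : (ℕ → γ) → β} (hΦ : Measurable Φ)
    (hU : ∀ t, Measurable (U t)) (hind : iIndepFun U P)
    (hid : ∀ t, IdentDistrib (U t) (U 0) P P) :
    StrictlyStationary P fun t ω => Φ fun k => U (t - k) ω := by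
  intro h
  have h0 := measurePreserving_iid_reindex hU hind hid (e := (id : ℤ → ℤ)) Function.injective_id
  have h1 := measurePreserving_iid_reindex hU hind hid (e := fun t : ℤ => t + h)
    (add_left_injective h)
  have hp := measurable_pathMap hΦ
  have e0 : (fun ω (t : ℤ) => Φ fun k => U (t - k) ω) = pathMap Φ ∘ fun ω t => U (id t) ω := rfl
  have e1 : (fun ω (t : ℤ) => Φ fun k => U (t + h - k) ω) =
      pathMap Φ ∘ fun ω t => U (t + h) ω := by
    funext ω
    exact (pathMap_shift Φ (fun t => U t ω) h).symm
  rw [e0, e1, ← Measure.map_map hp h0.measurable, ← Measure.map_map hp h1.measurable,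
    h0.map_eq, h1.map_eq]

variable [IsProbabilityMeasure P]

/-- A factor of an ergodic system is ergodic, and `pathMap Φ` is a factor map from the Bernoulli
shift. -/
theorem ergodicProcess_of_iid {Φ : (ℕ → γ) → β} (hΦ : Measurable Φ)
    (hU : ∀ t, Measurable (U t)) (hind : iIndepFun U P)
    (hid : ∀ t, IdentDistrib (U t) (U 0) P P) :
    ErgodicProcess P fun t ω => Φ fun k => U (t - k) ω := by
  have : IsProbabilityMeasure (P.map (U 0)) := Measure.isProbabilityMeasure_map (hU 0).aemeasurable
  exact (measurePreserving_pathMap hΦ hU hind hid).ergodic_of_ergodic_semiconj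
    (ergodic_shift_infinitePi (P.map (U 0))) (by fun_prop) fun u => pathMap_shift Φ u 1

/-- Each future value is replaced by its version of memory `m`, independent of the past once the gap
exceeds `m`. By stationarity each of the `l` replacements costs the same `L¹` error, and the factor
`1 / l` cancels their number. -/
theorem tauWeaklyDependent_of_iid {dx : ℕ} {Φ : (ℕ → γ) → State dx} (hΦ : Measurable Φ)
    (hint : Integrable Φ (Measure.infinitePi fun _ : ℕ => P.map (U 0)))
    (hU : ∀ t, Measurable (U t)) (hind : iIndepFun U P)
    (hid : ∀ t, IdentDistrib (U t) (U 0) P P) :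
    TauWeaklyDependent P fun t ω => Φ fun k => U (t - k) ω := by
  have : IsProbabilityMeasure (P.map (U 0)) := Measure.isProbabilityMeasure_map (hU 0).aemeasurable
  have hmp (t : ℤ) : MeasurePreserving (fun ω (k : ℕ) => U (t - k) ω) P
      (Measure.infinitePi fun _ : ℕ => P.map (U 0)) :=
    measurePreserving_iid_reindex hU hind hid (e := fun k : ℕ => t - k) fun a b hab => by
      simpa using hab
  have hZint (t : ℤ) : Integrable (fun ω => Φ fun k => U (t - k) ω) P :=
    (hmp t).integrable_comp_of_integrable hint
  refine ⟨hZint, ?_⟩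
  obtain ⟨Ψ, hΨm, hΨint, hΨ⟩ := exists_finiteMemory_tendsto hΦ hint
  -- Memory `m` reads the innovations at times `j - m, …, j`; a gap of `m + 1` puts them all
  -- strictly after `p`.
  rw [← tendsto_add_atTop_iff_nat 1]
  have h2 := ENNReal.Tendsto.const_mul hΨ (.inr (ENNReal.ofNat_ne_top (n := 2)))
  rw [mul_zero] at h2
  refine tendsto_zero_of_le h2 fun m => ?_
  refine iSup₂_le fun l hl => iSup_le fun p => iSup_le fun j => iSup₂_le fun _ hj => ?_
  have hΨm' : Measurable fun u : ℕ → γ => Ψ m fun i => u i := (hΨm m).comp (by fun_prop)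
  have hind' : IndepFun (fun ω (k : ℕ) => Φ fun i => U (p - k - i) ω)
      (fun ω (i : Fin l) => Ψ m fun k => U (j i - (k : ℕ)) ω) P := by
    have hdisj : Disjoint {t : ℤ | t ≤ p} {t | p < t} :=
      Set.disjoint_left.2 fun t (ht : t ≤ p) (ht' : p < t) => not_lt.2 ht ht'
    have hlt (i : Fin l) (k : Set.Iic m) : p < j i - (k : ℕ) := by
      have h1 := hj i
      have h2 : (k : ℕ) ≤ m := k.2
      push_cast at h1
      omega
    exact indepFun_of_factorsThrough_disjoint hU hind hdisj
      (F := fun v (k : ℕ) => Φ fun i => v ⟨p - k - i, by simp only [Set.mem_ofPred_eq]; omega⟩)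
      (G := fun v (i : Fin l) => Ψ m fun k => v ⟨j i - (k : ℕ), hlt i k⟩)
      (measurable_pi_lambda _ fun k => hΦ.comp (by fun_prop))
      (measurable_pi_lambda _ fun i => (hΨm m).comp (by fun_prop))
  have hτ := tauCoeff_le_of_indepFun (P := P) (W := fun ω (k : ℕ) => Φ fun i => U (p - k - i) ω)
    (V := fun ω (i : Fin l) => Φ fun k => U (j i - k) ω)
    (V' := fun ω (i : Fin l) => Ψ m fun k => U (j i - (k : ℕ)) ω)
    (measurable_pi_lambda _ fun k => hΦ.comp (hmp _).measurable)
    (measurable_pi_lambda _ fun i => hΦ.comp (hmp _).measurable)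
    (measurable_pi_lambda _ fun i => hΨm'.comp (hmp _).measurable)
    (fun i => hZint _) (fun i => (hmp (j i)).integrable_comp_of_integrable (hΨint m)) hind'
  have hterm (i : Fin l) : ∫⁻ ω, ENNReal.ofReal (stateNorm ((Φ fun k => U (j i - k) ω) -
        Ψ m fun k => U (j i - (k : ℕ)) ω)) ∂P =
      ∫⁻ u, ENNReal.ofReal (stateNorm (Φ u - Ψ m fun i => u i))
        ∂Measure.infinitePi fun _ : ℕ => P.map (U 0) :=
    (hmp (j i)).lintegral_comp (f := fun u => ENNReal.ofReal (stateNorm (Φ u - Ψ m fun i => u i)))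
      (ENNReal.measurable_ofReal.comp (continuous_stateNorm.measurable.comp (hΦ.sub hΨm')))
  simp only [hterm, Finset.sum_const, Finset.card_univ, Fintype.card_fin, nsmul_eq_mul] at hτ
  have hl0 : (l : ℝ≥0∞) ≠ 0 := by
    exact_mod_cast (Nat.one_le_iff_ne_zero.1 hl)
  refine (mul_le_mul_right hτ _).trans (le_of_eq ?_)
  rw [mul_left_comm, ← mul_assoc _ (l : ℝ≥0∞), ENNReal.inv_mul_cancel hl0 (by finiteness), one_mul]

end BernoulliFunctionals

/-! ### The two regimes of the model as Picard contractions. -/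

section Model

variable {Ω S : Type*} [MeasurableSpace Ω] [MeasurableSpace S] {P : Measure Ω}
  {d dx : ℕ} {f M : Family d dx} {θ : EuclideanSpace ℝ (Fin d)}
  {g : (ℕ → Cov dx) → S → Cov dx} {ξ : ℤ → Ω → ℝ} {η : ℤ → Ω → S} {r : ℝ} {αg : ℕ → ℝ≥0}

theorem A0With.enorm_sub_le {Ψ : Family d dx} {αY αX : ℕ → ℝ≥0} (h : A0With Ψ {θ} αY αX)
    (y y' : ℕ → ℝ) (x x' : ℕ → Cov dx) :
    ‖Ψ θ y x - Ψ θ y' x'‖ₑ ≤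
      (∑' k, (αY k : ℝ≥0∞) * ‖y k - y' k‖ₑ) + ∑' k, (αX k : ℝ≥0∞) * ‖x k - x' k‖ₑ := by
  simpa using h.lipschitz y y' x x'

theorem A0HWith.enorm_sub_le {αY αX : ℕ → ℝ≥0} (h : A0HWith f M {θ} αY αX)
    (y y' : ℕ → ℝ) (x x' : ℕ → Cov dx) :
    ‖M θ y x ^ 2 - M θ y' x' ^ 2‖ₑ ≤
      (∑' k, (αY k : ℝ≥0∞) * ‖y k ^ 2 - y' k ^ 2‖ₑ) + ∑' k, (αX k : ℝ≥0∞) * ‖x k - x' k‖ₑ := by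
  simpa using h.lipschitz y y' x x'

theorem tsum_coe_mul_ne_top {N : ℝ≥0∞} (hN : N ≠ ∞) {α : ℕ → ℝ≥0} (hα : Summable α) :
    ∑' k, N * (α k : ℝ≥0∞) ≠ ∞ := by
  rw [ENNReal.tsum_mul_left]
  exact ENNReal.mul_ne_top hN (ENNReal.tsum_coe_ne_top_iff_summable.2 hα)

/-- Under the conditions defining the first part of `Θ(r)`, the model is a Picard contraction. -/
theorem isPicardContraction_affine [IsProbabilityMeasure P]
    (hf_meas : Measurable fun p : (ℕ → ℝ) × (ℕ → Cov dx) => f θ p.1 p.2)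
    (hM_meas : Measurable fun p : (ℕ → ℝ) × (ℕ → Cov dx) => M θ p.1 p.2)
    (hg_meas : Measurable fun p : (ℕ → Cov dx) × S => g p.1 p.2)
    (hξ : Measurable (ξ 0)) (hη : Measurable (η 0)) (hr : 1 ≤ r)
    (hξ_r : MemLp (ξ 0) (ENNReal.ofReal r) P) (hg : CovariateContraction P g η r αg)
    {αfY αfX αMY αMX : ℕ → ℝ≥0} (hf : A0With f {θ} αfY αfX) (hM : A0With M {θ} αMY αMX)
    (hlt : ∑' k, max (αg k : ℝ≥0∞)
      (αfY k + eLpNorm (ξ 0) (ENNReal.ofReal r) P * αMY k) < 1) :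
    IsPicardContraction (P.map fun ω => (ξ 0 ω, η 0 ω))
      (fun y x u => M θ y x * u.1 + f θ y x) (fun x u => g x u.2) id r r
      (fun k => αg k) (fun k => αfY k + eLpNorm (ξ 0) (ENNReal.ofReal r) P * αMY k)
      (fun k => αfX k + eLpNorm (ξ 0) (ENNReal.ofReal r) P * αMX k) := by
  have hU : Measurable fun ω => (ξ 0 ω, η 0 ω) := hξ.prodMk hη
  have hr' : 1 ≤ ENNReal.ofReal r := by simpa using hr
  set N := eLpNorm (ξ 0) (ENNReal.ofReal r) P with hN
  have hgx (x : ℕ → Cov dx) : Measurable fun u : ℝ × S => g x u.2 :=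
    hg_meas.comp (measurable_const.prodMk measurable_snd)
  have key (y y' : ℕ → ℝ) (x x' : ℕ → Cov dx) :
      eLpNorm (fun u : ℝ × S => M θ y x * u.1 + f θ y x - (M θ y' x' * u.1 + f θ y' x'))
        (ENNReal.ofReal r) (P.map fun ω => (ξ 0 ω, η 0 ω)) ≤
      (∑' k, ((αfY k : ℝ≥0∞) + N * αMY k) * ‖y k - y' k‖ₑ) +
        ∑' k, ((αfX k : ℝ≥0∞) + N * αMX k) * ‖x k - x' k‖ₑ := by
    rw [eLpNorm_map_measure (Measurable.aestronglyMeasurable (by fun_prop)) hU.aemeasurable]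
    -- For frozen pasts the increment is affine in `ξ 0` with constant coefficients, so Minkowski
    -- yields the weights `αf + ‖ξ 0‖_r αM`.
    have e1 : ((fun u : ℝ × S => M θ y x * u.1 + f θ y x - (M θ y' x' * u.1 + f θ y' x')) ∘
        fun ω => (ξ 0 ω, η 0 ω)) =
        ((M θ y x - M θ y' x') • ξ 0) + fun _ => f θ y x - f θ y' x' := by
      ext ω
      simp
      ring
    rw [e1]
    refine (eLpNorm_add_le (hξ.aestronglyMeasurable.const_smul _)
      aestronglyMeasurable_const hr').trans ?_
    rw [eLpNorm_const_smul, eLpNorm_const _ (one_pos.trans_le hr').ne' (NeZero.ne P)]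
    simp only [measure_univ, ENNReal.one_rpow, mul_one]
    refine (add_le_add (mul_le_mul_left (hM.enorm_sub_le y y' x x') _)
      (hf.enorm_sub_le y y' x x')).trans (le_of_eq ?_)
    simp only [add_mul, ENNReal.tsum_add, mul_assoc, ENNReal.tsum_mul_left, ← hN]
    ring
  exact {
    one_le := hr
    le := le_rfl
    continuous := continuous_id
    measurable_fst := by
      have h1 : Measurable fun p : (ℝ × S) × (ℕ → ℝ) × (ℕ → Cov dx) => M θ p.2.1 p.2.2 :=
        hM_meas.comp measurable_snd
      have h2 : Measurable fun p : (ℝ × S) × (ℕ → ℝ) × (ℕ → Cov dx) => f θ p.2.1 p.2.2 :=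
        hf_meas.comp measurable_snd
      exact (h1.mul (measurable_fst.comp measurable_fst)).add h2
    measurable_snd := hg_meas.comp (measurable_snd.prodMk (measurable_snd.comp measurable_fst))
    snd_le := fun x x' => by
      rw [eLpNorm_map_measure (Measurable.aestronglyMeasurable
        (Measurable.fun_sub (hgx x) (hgx x'))) hU.aemeasurable]
      exact hg.lipschitz x x'
    comp_fst_le := key
    fst_le := fun y y' x x' => by
      rw [div_self (one_pos.trans_le hr).ne', ENNReal.rpow_one]
      exact key y y' x x'
    tsum_snd_lt_one := hg.sum_lt_one
    tsum_fst_lt_one := (ENNReal.tsum_le_tsum fun k => le_max_right _ _).trans_lt hlt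
    tsum_ne_top := by
      rw [ENNReal.tsum_add]
      exact ENNReal.add_ne_top.2 ⟨ENNReal.tsum_coe_ne_top_iff_summable.2 hf.summableX,
        tsum_coe_mul_ne_top hξ_r.eLpNorm_ne_top hM.summableX⟩
    snd_zero := by
      rw [eLpNorm_map_measure (hgx 0).aestronglyMeasurable hU.aemeasurable]
      exact hg.moment.eLpNorm_ne_top
    comp_fst_zero := by
      rw [eLpNorm_map_measure (Measurable.aestronglyMeasurable (by fun_prop)) hU.aemeasurable]
      simp only [id_eq, sub_zero]
      exact ((hξ_r.const_mul (M θ 0 0)).add (memLp_const (f θ 0 0))).eLpNorm_ne_top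
    fst_zero := by
      rw [eLpNorm_map_measure (Measurable.aestronglyMeasurable (by fun_prop)) hU.aemeasurable]
      exact ((hξ_r.const_mul (M θ 0 0)).add (memLp_const (f θ 0 0))).eLpNorm_ne_top }

theorem eLpNorm_sq_half {α : Type*} [MeasurableSpace α] {ν : Measure α} (hr : 0 < r)
    (X : α → ℝ) :
    eLpNorm (fun a => X a ^ 2) (ENNReal.ofReal (r / 2)) ν =
      eLpNorm X (ENNReal.ofReal r) ν ^ 2 := by
  have h := eLpNorm_rpow_ennreal (ν := ν) (half_pos hr) (two_pos (α := ℝ)) fun a => ‖X a‖ₑ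
  rw [mul_div_cancel₀ _ two_ne_zero, eLpNorm_enorm, ENNReal.rpow_two] at h
  rw [← h, ← eLpNorm_enorm fun a => X a ^ 2]
  simp [enorm_pow]

/-- Because `|a - b| ≤ a + b` for non-negative numbers. Applied to values of `M`, it is what
recovers `Y` from the contraction of `Y²`; for `a = -b ≠ 0` it fails. -/
theorem enorm_sub_sq_le {a b : ℝ} (ha : 0 ≤ a) (hb : 0 ≤ b) :
    ‖a - b‖ₑ ^ 2 ≤ ‖a ^ 2 - b ^ 2‖ₑ := by
  rw [← enorm_pow, Real.enorm_eq_ofReal_abs, Real.enorm_eq_ofReal_abs]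
  refine ENNReal.ofReal_le_ofReal ?_
  rw [abs_of_nonneg (sq_nonneg _), sq_sub_sq, abs_mul, abs_of_nonneg (add_nonneg ha hb), sq,
    ← abs_mul_abs_self]
  exact mul_le_mul_of_nonneg_right (abs_sub_le_of_nonneg_of_le ha (by linarith) hb (by linarith))
    (abs_nonneg _)

/-- Under the conditions defining the second part of `Θ(r)`, with `M_θ ≥ 0` and `r ≥ 2`, the model
is a Picard contraction for the squares `Y_t ^ 2`. -/
theorem isPicardContraction_ARCH
    (hM_meas : Measurable fun p : (ℕ → ℝ) × (ℕ → Cov dx) => M θ p.1 p.2)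
    (hg_meas : Measurable fun p : (ℕ → Cov dx) × S => g p.1 p.2)
    (hξ : Measurable (ξ 0)) (hη : Measurable (η 0)) (hr : 2 ≤ r)
    (hξ_r : MemLp (ξ 0) (ENNReal.ofReal r) P) (hg : CovariateContraction P g η r αg)
    {αHY αHX : ℕ → ℝ≥0} (hH : A0HWith f M {θ} αHY αHX) (hM : ∀ y x, 0 ≤ M θ y x)
    (hlt : eLpNorm (ξ 0) (ENNReal.ofReal r) P ^ 2 *
      ∑' k, max (αg k : ℝ≥0∞) (αHY k) < 1) :
    IsPicardContraction (P.map fun ω => (ξ 0 ω, η 0 ω))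
      (fun y x u => M θ y x * u.1 + f θ y x) (fun x u => g x u.2) (fun y => y ^ 2) (r / 2) r
      (fun k => αg k) (fun k => eLpNorm (ξ 0) (ENNReal.ofReal r) P ^ 2 * αHY k)
      (fun k => eLpNorm (ξ 0) (ENNReal.ofReal r) P ^ 2 * αHX k) := by
  have hU : Measurable fun ω => (ξ 0 ω, η 0 ω) := hξ.prodMk hη
  have hr0 : 0 < r := by linarith
  simp only [fun y x => hH.f_eq_zero θ rfl y x, add_zero]
  set N := eLpNorm (ξ 0) (ENNReal.ofReal r) P with hN
  have hNtop : N ^ 2 ≠ ∞ := ENNReal.pow_ne_top hξ_r.eLpNorm_ne_top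
  have hgx (x : ℕ → Cov dx) : Measurable fun u : ℝ × S => g x u.2 :=
    hg_meas.comp (measurable_const.prodMk measurable_snd)
  have hsum (y y' : ℕ → ℝ) (x x' : ℕ → Cov dx) : ‖M θ y x ^ 2 - M θ y' x' ^ 2‖ₑ * N ^ 2 ≤
      (∑' k, (N ^ 2 * (αHY k : ℝ≥0∞)) * ‖y k ^ 2 - y' k ^ 2‖ₑ) +
        ∑' k, (N ^ 2 * (αHX k : ℝ≥0∞)) * ‖x k - x' k‖ₑ := by
    refine (mul_le_mul_left (hH.enorm_sub_le y y' x x') _).trans (le_of_eq ?_)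
    simp only [mul_assoc, ENNReal.tsum_mul_left]
    ring
  have hsq (m : ℝ) : eLpNorm (fun ω => m * ξ 0 ω ^ 2) (ENNReal.ofReal (r / 2)) P =
      ‖m‖ₑ * N ^ 2 := by
    rw [hN, ← eLpNorm_sq_half hr0]
    exact eLpNorm_const_smul m (fun ω => ξ 0 ω ^ 2) _ _
  exact {
    -- Here `q = r / 2`, so `r ≥ 2` is exactly what makes `L^q` normed.
    one_le := by linarith
    le := by linarith
    continuous := continuous_pow 2
    measurable_fst := by
      have h1 : Measurable fun p : (ℝ × S) × (ℕ → ℝ) × (ℕ → Cov dx) => M θ p.2.1 p.2.2 :=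
        hM_meas.comp measurable_snd
      exact h1.mul (measurable_fst.comp measurable_fst)
    measurable_snd := hg_meas.comp (measurable_snd.prodMk (measurable_snd.comp measurable_fst))
    snd_le := fun x x' => by
      rw [eLpNorm_map_measure (Measurable.aestronglyMeasurable
        (Measurable.fun_sub (hgx x) (hgx x'))) hU.aemeasurable]
      exact hg.lipschitz x x'
    comp_fst_le := fun y y' x x' => by
      rw [eLpNorm_map_measure (Measurable.aestronglyMeasurable (by fun_prop)) hU.aemeasurable]
      refine le_trans (le_of_eq ?_) (hsum y y' x x')
      rw [← hsq]
      congr 1 with ω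
      simp only [Function.comp_apply]
      ring
    fst_le := fun y y' x x' => by
      rw [eLpNorm_map_measure (Measurable.aestronglyMeasurable (by fun_prop)) hU.aemeasurable]
      have e1 : ((fun u : ℝ × S => M θ y x * u.1 - M θ y' x' * u.1) ∘
          fun ω => (ξ 0 ω, η 0 ω)) = (M θ y x - M θ y' x') • ξ 0 := by
        ext ω
        simp
        ring
      -- The Hölder exponent `q / r` equals 1/2, so the claim is squared and reduces to the
      -- comparison of `|M - M'|²` with `|M² - M'²|`.
      rw [e1, eLpNorm_const_smul, ← hN, show r / 2 / r = (2 : ℝ)⁻¹ by field_simp,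
        ENNReal.le_rpow_inv_iff two_pos, ENNReal.rpow_two, mul_pow]
      exact (mul_le_mul_left (enorm_sub_sq_le (hM y x) (hM y' x')) _).trans (hsum y y' x x')
    tsum_snd_lt_one := hg.sum_lt_one
    tsum_fst_lt_one := by
      rw [ENNReal.tsum_mul_left]
      exact (mul_le_mul_right (ENNReal.tsum_le_tsum fun k => le_max_right _ _) _).trans_lt hlt
    tsum_ne_top := tsum_coe_mul_ne_top hNtop hH.summableX
    snd_zero := by
      rw [eLpNorm_map_measure (hgx 0).aestronglyMeasurable hU.aemeasurable]
      exact hg.moment.eLpNorm_ne_top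
    comp_fst_zero := by
      rw [eLpNorm_map_measure (Measurable.aestronglyMeasurable (by fun_prop)) hU.aemeasurable]
      have h := hsq (M θ 0 0 ^ 2)
      have e1 : ((fun u : ℝ × S => (M θ 0 0 * u.1) ^ 2 - 0 ^ 2) ∘ fun ω => (ξ 0 ω, η 0 ω)) =
          fun ω => M θ 0 0 ^ 2 * ξ 0 ω ^ 2 := by
        ext ω
        simp only [Function.comp_apply]
        ring
      rw [e1, h]
      exact ENNReal.mul_ne_top (by finiteness) hNtop
    fst_zero := by
      rw [eLpNorm_map_measure (Measurable.aestronglyMeasurable (by fun_prop)) hU.aemeasurable]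
      exact (hξ_r.const_mul (M θ 0 0)).eLpNorm_ne_top }

end Model

end ACX

/-! ### Assembly of the solution. -/

theorem proposition1 {Ω S : Type*} [MeasurableSpace Ω] [MeasurableSpace S]
    (P : Measure Ω) [IsProbabilityMeasure P] {d dx : ℕ}
    (Θ : Set (EuclideanSpace ℝ (Fin d))) (hΘ : IsCompact Θ)
    (f M : ACX.Family d dx)
    (hf_meas : ∀ θ ∈ Θ, Measurable fun p : (ℕ → ℝ) × (ℕ → ACX.Cov dx) => f θ p.1 p.2)
    (hM_meas : ∀ θ ∈ Θ, Measurable fun p : (ℕ → ℝ) × (ℕ → ACX.Cov dx) => M θ p.1 p.2)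
    (g : (ℕ → ACX.Cov dx) → S → ACX.Cov dx)
    (hg_meas : Measurable fun p : (ℕ → ACX.Cov dx) × S => g p.1 p.2)
    (ξ : ℤ → Ω → ℝ) (η : ℤ → Ω → S)
    (hξ_meas : ∀ t, Measurable (ξ t)) (hη_meas : ∀ t, Measurable (η t))
    (h_indep : iIndepFun (fun t ω => (ξ t ω, η t ω)) P)
    (h_ident : ∀ t, IdentDistrib (fun ω => (ξ t ω, η t ω)) (fun ω => (ξ 0 ω, η 0 ω)) P P)
    (hξ_mean : ∫ ω, ξ 0 ω ∂P = 0) (hξ_var : ∫ ω, ξ 0 ω ^ 2 ∂P = 1)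
    (r : ℝ) (hr : 1 ≤ r) (hξ_r : MemLp (ξ 0) (ENNReal.ofReal r) P)
    (hA0 : (ACX.A0 f Θ ∧ ACX.A0 M Θ) ∨ ACX.A0H f M Θ)
    (αg : ℕ → ℝ≥0) (hg : ACX.CovariateContraction P g η r αg)
    (θs : EuclideanSpace ℝ (Fin d))
    (hθ : θs ∈ Θ ∩ ACX.stationaritySet P f M ξ r αg)
    (hARCH : θs ∉ ACX.stationaritySetAffine P f M ξ r αg → 2 ≤ r ∧ ∀ y x, 0 ≤ M θs y x) :
    ∃ Z : ℤ → Ω → ACX.State dx,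
      (∀ t, Measurable (Z t)) ∧
      ACX.IsSolution P f M θs g ξ η Z ∧
      ACX.TauWeaklyDependent P Z ∧
      ACX.StrictlyStationary P Z ∧
      ACX.ErgodicProcess P Z ∧
      ACX.NonAnticipative P (fun t ω => (ξ t ω, η t ω)) Z ∧
      MemLp (fun ω => ACX.stateNorm (Z 0 ω)) (ENNReal.ofReal r) P := by
  set U : ℤ → Ω → ℝ × S := fun t ω => (ξ t ω, η t ω) with hU
  have hUm (t : ℤ) : Measurable (U t) := (hξ_meas t).prodMk (hη_meas t)
  have hμ : IsProbabilityMeasure (P.map (U 0)) :=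
    Measure.isProbabilityMeasure_map (hUm 0).aemeasurable
  -- From here on the two regimes are treated alike: only the existence of some `ψ` and `q` matters.
  obtain ⟨ψ, q, a, b, c, hcontr⟩ : ∃ (ψ : ℝ → ℝ) (q : ℝ) (a b c : ℕ → ℝ≥0∞),
      ACX.IsPicardContraction (P.map (U 0)) (fun y x u => M θs y x * u.1 + f θs y x)
        (fun x u => g x u.2) ψ q r a b c := by
    by_cases h : θs ∈ ACX.stationaritySetAffine P f M ξ r αg
    · obtain ⟨αfY, αfX, αMY, αMX, hf, hM, hlt⟩ := h
      exact ⟨_, _, _, _, _, ACX.isPicardContraction_affine (hf_meas θs hθ.1) (hM_meas θs hθ.1)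
        hg_meas (hξ_meas 0) (hη_meas 0) hr hξ_r hg hf hM hlt⟩
    · obtain ⟨αHY, αHX, hH, hlt⟩ := hθ.2.resolve_left h
      exact ⟨_, _, _, _, _, ACX.isPicardContraction_ARCH (hM_meas θs hθ.1) hg_meas (hξ_meas 0)
        (hη_meas 0) (hARCH h).1 hξ_r hg hH (hARCH h).2 hlt⟩
  obtain ⟨Φ, hΦm, hΦr, hΦ⟩ := hcontr.exists_fixedPoint
  have hmp (t : ℤ) : MeasurePreserving (fun ω (k : ℕ) => U (t - k) ω) P
      (Measure.infinitePi fun _ : ℕ => P.map (U 0)) :=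
    ACX.measurePreserving_iid_reindex hUm h_indep h_ident (e := fun k : ℕ => t - k)
      fun a b hab => by simpa using hab
  have hint : Integrable Φ (Measure.infinitePi fun _ : ℕ => P.map (U 0)) :=
    hΦr.integrable (by simpa using hr)
  refine ⟨fun t ω => Φ fun k => U (t - k) ω, fun t => hΦm.comp (hmp t).measurable, fun t => ?_,
    ACX.tauWeaklyDependent_of_iid hΦm hint hUm h_indep h_ident,
    ACX.strictlyStationary_of_iid hΦm hUm h_indep h_ident,
    ACX.ergodicProcess_of_iid hΦm hUm h_indep h_ident, ⟨Φ, hΦm, fun t => .of_forall fun _ => rfl⟩,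
    ?_⟩
  -- The fixed-point equation holds almost surely for the product law and is pulled back along `ω ↦
  -- (U t, U (t - 1), …)`. Dropping the `k + 1` newest innovations gives the sequence seen at time
  -- `t - 1 - k`, which matches `lags`.
  · filter_upwards [(hmp t).quasiMeasurePreserving.ae hΦ] with ω hω
    have hlag (k : ℕ) : (fun j : ℕ => U (t - ((j + k + 1 : ℕ) : ℤ)) ω) =
        fun j : ℕ => U (t - 1 - k - j) ω := by
      funext j
      congr 1
      push_cast
      ring
    simp only [ACX.picardStep, hlag, Nat.cast_zero, sub_zero] at hω
    exact ⟨congrArg Prod.fst hω, congrArg Prod.snd hω⟩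
  · have h0 : MemLp (fun ω => Φ fun k : ℕ => U (0 - k) ω) (ENNReal.ofReal r) P :=
      hΦr.comp_measurePreserving (hmp 0)
    refine (h0.norm.const_mul 2).mono' (ACX.continuous_stateNorm.comp_aestronglyMeasurable h0.1)
      (.of_forall fun ω => ?_)
    rw [Real.norm_of_nonneg (ACX.stateNorm_nonneg _)]
    exact ACX.stateNorm_le_two_mul_norm _
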